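/- \textbf{Setting.} Let $d\ge 3$, $\Lambda=\mathbb R^d/\mathbb Z^d$ with its flat distance $|x-y|$, $\mathbb D=\Lambda\times\mathbb R^d$, $M(v)=(2\pi)^{-d/2}e^{-\|v\|^2/2}$. For $\varepsilon>0$ let $\mu_\varepsilon$ be given by $\mu_\varepsilon\varepsilon^{d-1}=1$. The grand canonical hard sphere Gibbs measure $\mathbb P_\varepsilon$, with expectation $\mathbb E_\varepsilon$, is the probability measure on $\bigsqcup_{N\ge0}\mathbb D^N$ whose restriction to $\mathbb D^N$ is $\frac1{\mathcal Z_\varepsilon}\frac{\mu_\varepsilon^N}{N!}\mathbf 1_{\{|x_i-x_j|>\varepsilon\ \forall i\ne j\}}\prod_{i=1}^N M(v_i)\,dx_i\,dv_i$, where $\mathcal Z_\varepsilon$ is the normalising constant; a random configuration is written $\mathbf Z_{\mathcal N}=(\mathbf z_1,\dots,\mathbf z_{\mathcal N})$. For a function $g_n$ on $\mathbb D^n$ put $$\mathbb E_\varepsilon[g_n]:=\mathbb E_\varepsilon\Big[\frac1{\mu_\varepsilon^n}\sum_{(i_1,\dots,i_n)}g_n(\mathbf z_{i_1},\dots,\mathbf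 z_{i_n})\Big],\qquad \hat g_n(\mathbf Z_{\mathcal N}):=\frac1{\mu_\varepsilon^n}\sum_{(i_1,\dots,i_n)}g_n(\mathbf z_{i_1},\dots,\mathbf z_{i_n})-\mathbb E_\varepsilon[g_n],$$ the sums being over ordered $n$-tuples of pairwise distinct indices in $\{1,\dots,\mathcal N\}$. For $Z_n=(z_1,\dots,z_n)\in\mathbb D^n$, $z_i=(x_i,v_i)$, write $Z_{a,b}=(z_a,\dots,z_b)$, $X_{a,b}=(x_a,\dots,x_b)$, $V_n=(v_1,\dots,v_n)$, and let $\tau_yZ_n$ be $Z_n$ with every $x_i$ replaced by $x_i+y$. \textbf{Theorem (quasi-orthogonality estimates).} There are constants $C,K>0$ depending only on $d$ such that the following holds for every $\varepsilon>0$ and all integers $1\le m\le n$. Let $g_n:\mathbb D^n\to\mathbb R$ and $h_m:\mathbb D^m\to\mathbb R$ be measurable and let $c_0,c_0',c_1,\dots,c_m\ge0$ satisfy $$\int_{x_1=0}\sup_{y\in\Lambda}|g_n(\tau_yZ_n)|\,M^{\otimes n}(V_n)\,dX_{2,n}\,dV_n\le c_0,\qquad \int_{x_1=0}\sup_{y\in\Lambda}|h_m(\tau_yZ_m)|\,M^{\otimes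 m}(V_m)\,dX_{2,m}\,dV_m\le c_0',$$ and, for every $l\in\{1,\dots,m\}$, $$\int_{x_1=0}\sup_{y\in\Lambda}\big|g_n(\tau_yZ_{1,n})\,h_m(\tau_yZ_{n+1-l,n+m-l})\big|\,M^{\otimes(n+m-l)}(V_{n+m-l})\,dX_{2,n+m-l}\,dV_{n+m-l}\le\frac{\mu_\varepsilon^{l-1}}{n^l}\,c_l .$$ Then the expectations $\mathbb E_\varepsilon[g_n]$, $\mathbb E_\varepsilon[h_m]$ are absolutely convergent and $$|\mathbb E_\varepsilon[g_n]|\le C^nc_0,\qquad|\mathbb E_\varepsilon[h_m]|\le C^mc_0'.$$ If moreover $g_n$ and $h_m$ are symmetric under permutations of their arguments $z_i$, put, for $1\le l\le m$, $$g_n\circledast_lh_m(Z_{n+m-l}):=\frac1{(n+m-l)!}\sum_{\sigma\in\mathfrak S_{n+m-l}}g_n(z_{\sigma(1)},\dots,z_{\sigma(n)})\,h_m(z_{\sigma(n+1-l)},\dots,z_{\sigma(n+m-l)}).$$ Then $\mu_\varepsilon\hat g_n\hat h_m$ is integrable, the expectations $\mathbb E_\varepsilon[g_n\circledast_lh_m]$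 are absolutely convergent, and $$\Big|\mathbb E_\varepsilon\big[\mu_\varepsilon\hat g_n\hat h_m\big]-\sum_{l=1}^m\binom nl\binom ml\frac{l!}{\mu_\varepsilon^{l-1}}\,\mathbb E_\varepsilon\big[g_n\circledast_lh_m\big]\Big|\le K\,C^{n+m}c_0c_0'\,\varepsilon .$$ In particular, $$\big|\mathbb E_\varepsilon\big[\mu_\varepsilon\hat g_n\hat h_m\big]\big|\le C^{n+m}\sum_{l=1}^mc_l+C^nc_0c_0'\,\varepsilon .$$ -/

import Mathlib

open MeasureTheory
open scoped ENNReal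

noncomputable section

namespace HardSphere

/-- The flat torus `ℝ^d / ℤ^d`, with its Haar (Lebesgue) probability measure `volume`. -/
abbrev Torus (d : ℕ) : Type := Fin d → UnitAddCircle

/-- Velocities, with the Euclidean norm and Lebesgue measure. -/
abbrev Vel (d : ℕ) : Type := EuclideanSpace ℝ (Fin d)

/-- The one-particle phase space, with points `z = (x, v)`. -/
abbrev Phase (d : ℕ) : Type := Torus d × Vel d

/-- The flat (Euclidean) distance on the torus; the built-in distance of a product type is the
sup distance and is not used. -/
def torusDist {d : ℕ} (x y : Torus d) : ℝ := Real.sqrt (∑ k, ‖x k - y k‖ ^ 2)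

/-- The Maxwellian `M(v) = (2π)^{-d/2} exp(-‖v‖²/2)`. -/
def maxwellian {d : ℕ} (v : Vel d) : ℝ :=
  (2 * Real.pi) ^ (-(d : ℝ) / 2) * Real.exp (-‖v‖ ^ 2 / 2)

/-- The measure `M(v) dv`. -/
def maxwellMeasure (d : ℕ) : Measure (Vel d) :=
  volume.withDensity fun v => ENNReal.ofReal (maxwellian v)

/-- The measure `M^{⊗n}(V_n) dX_n dV_n` on the space of `n`-particle configurations. -/
def refMeasure (d n : ℕ) : Measure (Fin n → Phase d) :=
  Measure.pi fun _ => (volume : Measure (Torus d)).prod (maxwellMeasure d)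

/-- The measure `M^{⊗n}(V_n) dX_{2,n} dV_n` on the slice `x_1 = 0`: the position of the first
particle is frozen at the origin, all the other variables are integrated. -/
def pinnedMeasure (d n : ℕ) : Measure (Fin n → Phase d) :=
  Measure.pi fun i =>
    (if (i : ℕ) = 0 then Measure.dirac 0 else (volume : Measure (Torus d))).prod (maxwellMeasure d)

/-- The `n`-particle hard sphere phase space: all pairwise distances exceed `ε`. -/
def hardCore (d : ℕ) (ε : ℝ) (n : ℕ) : Set (Fin n → Phase d) :=
  {Z | ∀ i j, i ≠ j → ε < torusDist (Z i).1 (Z j).1}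

/-- Configurations with an arbitrary finite number of particles. -/
abbrev Config (d : ℕ) : Type := Σ N : ℕ, Fin N → Phase d

/-- The Boltzmann-Grad activity, determined by `μ_ε ε^{d-1} = 1`. -/
def activity (d : ℕ) (ε : ℝ) : ℝ := (ε ^ (d - 1))⁻¹

/-- The unnormalised grand canonical measure `∑_N (μ_ε^N / N!) e^{-H_N} / (2π)^{Nd/2} dZ_N`.
The hard core part of `e^{-H_N}` is the indicator of `hardCore d ε N` and its kinetic part,
divided by `(2π)^{Nd/2}`, is `M^{⊗N}`. -/
def gibbsWeight (d : ℕ) (ε : ℝ) : Measure (Config d) :=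
  Measure.sum fun N : ℕ =>
    ENNReal.ofReal (activity d ε ^ N / (N.factorial : ℝ)) •
      ((refMeasure d N).restrict (hardCore d ε N)).map (Sigma.mk N)

/-- The grand canonical Gibbs measure; the normalising constant is the partition function. -/
def gibbs (d : ℕ) (ε : ℝ) : Measure (Config d) :=
  (gibbsWeight d ε Set.univ)⁻¹ • gibbsWeight d ε

/-- `μ_ε^{-n} ∑_{(i_1, …, i_n)} g(z_{i_1}, …, z_{i_n})`, the sum being over all ordered `n`-tuples
of pairwise distinct particles of the configuration. -/
def empirical {d n : ℕ} (ε : ℝ) (g : (Fin n → Phase d) → ℝ) (ω : Config d) : ℝ :=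
  (activity d ε ^ n)⁻¹ * ∑ i : Fin n ↪ Fin ω.1, g fun k => ω.2 (i k)

/-- `𝔼_ε[g_n]`. -/
def mean {d n : ℕ} (ε : ℝ) (g : (Fin n → Phase d) → ℝ) : ℝ :=
  ∫ ω, empirical ε g ω ∂(gibbs d ε)

/-- The centred observable `ĝ_n`. -/
def centred {d n : ℕ} (ε : ℝ) (g : (Fin n → Phase d) → ℝ) (ω : Config d) : ℝ :=
  empirical ε g ω - mean ε g

/-- Translation `τ_y` of all the positions. -/
def translate {d n : ℕ} (y : Torus d) (Z : Fin n → Phase d) : Fin n → Phase d :=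
  fun i => ((Z i).1 + y, (Z i).2)

/-- `∫_{x_1 = 0} sup_y |g(τ_y Z_n)| M^{⊗n}(V_n) dX_{2,n} dV_n`, as an extended nonnegative real. -/
def transSup {d n : ℕ} (g : (Fin n → Phase d) → ℝ) : ℝ≥0∞ :=
  ∫⁻ Z, ⨆ y : Torus d, ‖g (translate y Z)‖ₑ ∂(pinnedMeasure d n)

/-- `Z_{n+m-l} ↦ g(Z_{1,n}) h(Z_{n+1-l,n+m-l})`, for `l ≤ n` and `l ≤ m`: the last `l` arguments of
`g` are the first `l` arguments of `h`. (The value for other `l` is irrelevant.) -/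
def overlap {d n m : ℕ} (g : (Fin n → Phase d) → ℝ) (h : (Fin m → Phase d) → ℝ) (l : ℕ)
    (Z : Fin (n + m - l) → Phase d) : ℝ :=
  if hl : l ≤ n ∧ l ≤ m then
    g (fun i => Z ⟨i, by have := i.2; omega⟩) * h (fun j => Z ⟨n - l + j, by have := j.2; omega⟩)
  else 0

/-- The symmetrised contraction `g ⊛_l h`. -/
def contraction {d n m : ℕ} (g : (Fin n → Phase d) → ℝ) (h : (Fin m → Phase d) → ℝ) (l : ℕ)
    (Z : Fin (n + m - l) → Phase d) : ℝ :=
  ((n + m - l).factorial : ℝ)⁻¹ *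
    ∑ σ : Equiv.Perm (Fin (n + m - l)), overlap g h l fun i => Z (σ i)

/-- Invariance under permutations of the particles. -/
def IsSymm {d n : ℕ} (g : (Fin n → Phase d) → ℝ) : Prop :=
  ∀ (σ : Equiv.Perm (Fin n)) (Z : Fin n → Phase d), g (fun i => Z (σ i)) = g Z

end HardSphere

end

/-! The product of two sums over tuples of distinct particles splits exactly according to the number
`l` of particles that the tuples share (`empirical_mul_empirical`). The terms with `l ≥ 1` give
precisely the contraction sum of the theorem. Hence the quantity to be bounded equals `μ (E[g ⊗ h] -
E[g] E[h])`, where `E[g ⊗ h]` runs over disjoint tuples; this is `μ` times the integral of `g ⊗ h`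
against the truncated correlation `u(X, X') = ρ(X, X') - ρ(X) ρ(X')` (`mean_overlap_zero_sub`). Here
`ρ` is `corr`, the correlation function divided by the power of the activity.

At every density `0 ≤ ρ ≤ 1`, because fixing points only removes configurations (`corr_le_one`).
This alone bounds the means, and it gives `|u| ≤ 1`.

The core is the estimate that `∫ |u(X, τ_y Z)| dy` is of order `2 ^ (n + m) * ε ^ d`, uniformly in
`X` and `Z`; as `μ ε ^ d = ε`, this is the required order. It suffices because the supremum over
translations of `|h|` can be taken out of the integral over `y` (`enorm_integral_mul_trunc_le`). To
prove it, subtract two Kirkwood-Salsburg equations: `u` satisfies a linear equation in its first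
group of points, whose source vanishes unless the removed point overlaps `X'`, an event of small
probability in `y` (`truncCorr_cons`). The equation trades one point for `k` new ones at a cost of
at most `a ^ k / k!`, with `a = 2 ^ d * ε`. In the supremum norm weighted by `2 ^ |X|` its operator
therefore has norm at most `exp (2 * a) / 2`, which is below `3 / 4` when `a ≤ 1 / 8`. Iterating
from `|u| ≤ 1` gives the estimate (`lintegral_truncCorr_le`). For larger `ε` the bound `|u| ≤ 1` is
already enough.

The last inequality of the theorem then follows from `binom n l * l! ≤ n ^ l`, which absorbs the
factor `n ^ (-l)` in the hypothesis. -/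

noncomputable section

namespace HardSphere

/-! ### Hard-core indicators for an abstract relation -/

section Indicators

variable {E ι κ : Type*}

open Classical in
/-- The indicator function of the configurations whose points are pairwise related by `R`. -/
def compat (R : E → E → Prop) (X : ι → E) : ℝ := if ∀ i j, i ≠ j → R (X i) (X j) then 1 else 0

theorem compat_congr {R : E → E → Prop} {X : ι → E} {Y : κ → E}
    (h : (∀ i j, i ≠ j → R (X i) (X j)) ↔ ∀ i j, i ≠ j → R (Y i) (Y j)) :
    compat R X = compat R Y := by
  classical
  exact if_congr h rfl rfl

theorem compat_nonneg (R : E → E → Prop) (X : ι → E) : 0 ≤ compat R X := by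
  unfold compat; split_ifs <;> norm_num

theorem compat_le_one (R : E → E → Prop) (X : ι → E) : compat R X ≤ 1 := by
  unfold compat; split_ifs <;> norm_num

theorem compat_comp_equiv (R : E → E → Prop) (X : κ → E) (e : ι ≃ κ) :
    compat R (fun i => X (e i)) = compat R X := by
  refine compat_congr ⟨fun h i j hij => ?_, fun h i j hij => h _ _ (e.injective.ne hij)⟩
  simpa using h (e.symm i) (e.symm j) (e.symm.injective.ne hij)

/-- Forgetting points can only relax the exclusion. This monotonicity is the origin of
`corr_le_one`. -/
theorem compat_mono (R : E → E → Prop) (X : κ → E) {e : ι → κ} (he : Function.Injective e) :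
    compat R X ≤ compat R (fun i => X (e i)) := by
  unfold compat
  split_ifs with h1 h2
  · exact le_rfl
  · exact absurd (fun i j hij => h1 _ _ (he.ne hij)) h2
  · norm_num
  · exact le_rfl

open Classical in
/-- The indicator function of the points that are not related to `x`. -/
def clash (R : E → E → Prop) (x y : E) : ℝ := if R x y then 0 else 1

theorem clash_nonneg (R : E → E → Prop) (x y : E) : 0 ≤ clash R x y := by
  unfold clash; split_ifs <;> norm_num

theorem clash_le_one (R : E → E → Prop) (x y : E) : clash R x y ≤ 1 := by
  unfold clash; split_ifs <;> norm_num

/-- Singling out one point leaves a product of factors `1 - clash`, whose expansion produces the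
Kirkwood-Salsburg equation. -/
theorem compat_cons {R : E → E → Prop} (hs : ∀ x y, R x y → R y x) [Fintype ι] (x : E)
    (X : ι → E) :
    compat R (Sum.elim (fun _ : Unit => x) X) = (∏ i, (1 - clash R x (X i))) * compat R X := by
  by_cases h1 : ∀ i, R x (X i)
  · have : ∏ i, (1 - clash R x (X i)) = 1 := by
      refine Finset.prod_eq_one fun i _ => ?_
      simp [clash, h1 i]
    rw [this, one_mul]
    refine compat_congr ⟨fun h i j hij => ?_, fun h => ?_⟩
    · simpa using h (Sum.inr i) (Sum.inr j) (by simpa using hij)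
    · rintro (i | i) (j | j) hij
      · exact absurd rfl hij
      · exact h1 j
      · exact hs _ _ (h1 i)
      · exact h i j (by simpa using hij)
  · obtain ⟨i, hi⟩ := not_forall.1 h1
    have : ∏ i, (1 - clash R x (X i)) = 0 := by
      refine Finset.prod_eq_zero (Finset.mem_univ i) ?_
      simp [clash, hi]
    rw [this, zero_mul]
    refine if_neg fun h => hi ?_
    simpa using h (Sum.inl ()) (Sum.inr i) (by simp)

theorem prod_one_sub_clash_mem (R : E → E → Prop) [Fintype ι] (x : E) (X : ι → E) :
    0 ≤ ∏ i, (1 - clash R x (X i)) ∧ ∏ i, (1 - clash R x (X i)) ≤ 1 :=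
  ⟨Finset.prod_nonneg fun _ _ => sub_nonneg.2 (clash_le_one R x _),
    Finset.prod_le_one (fun _ _ => sub_nonneg.2 (clash_le_one R x _))
      fun _ _ => sub_le_self _ (clash_nonneg R x _)⟩

theorem prod_clash_mem (R : E → E → Prop) (s : Finset ι) (x : E) (X : ι → E) :
    0 ≤ ∏ i ∈ s, clash R x (X i) ∧ ∏ i ∈ s, clash R x (X i) ≤ 1 :=
  ⟨Finset.prod_nonneg fun _ _ => clash_nonneg R x _,
    Finset.prod_le_one (fun _ _ => clash_nonneg R x _) fun _ _ => clash_le_one R x _⟩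

theorem one_sub_prod_clash_le (R : E → E → Prop) [Fintype κ] (x : E) (X' : κ → E) :
    1 - ∏ j, (1 - clash R x (X' j)) ≤ ∑ j, clash R x (X' j) := by
  have h : ∀ s : Finset κ, 1 - ∏ j ∈ s, (1 - clash R x (X' j)) ≤ ∑ j ∈ s, clash R x (X' j) := by
    intro s
    induction s using Finset.cons_induction with
    | empty => simp
    | cons j s hj ih =>
      rw [Finset.prod_cons, Finset.sum_cons]
      have h1 : ∏ i ∈ s, (1 - clash R x (X' i)) ≤ 1 :=
        Finset.prod_le_one (fun _ _ => sub_nonneg.2 (clash_le_one R x _))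
          fun _ _ => sub_le_self _ (clash_nonneg R x _)
      have h2 := mul_le_of_le_one_right (clash_nonneg R x (X' j)) h1
      linarith
  exact h Finset.univ

end Indicators

/-! ### Partition functions and correlation functions -/

section Correlation

variable {E : Type*} [MeasurableSpace E] {ι κ : Type*} {α β γ : Type*}


theorem measurable_compat {R : E → E → Prop} (hR : MeasurableSet {p : E × E | R p.1 p.2})
    [Countable ι] : Measurable (compat R : (ι → E) → ℝ) := by
  refine Measurable.ite ?_ measurable_const measurable_const
  simp only [Set.ofPred_forall]
  refine MeasurableSet.iInter fun i => MeasurableSet.iInter fun j => MeasurableSet.iInter fun _ => ?_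
  exact measurableSet_preimage (f := fun X : ι → E => (X i, X j))
    ((measurable_pi_apply i).prodMk (measurable_pi_apply j)) hR

theorem measurable_clash {R : E → E → Prop} (hR : MeasurableSet {p : E × E | R p.1 p.2}) (x : E) :
    Measurable (clash R x) :=
  Measurable.ite (hR.preimage measurable_prodMk_left) measurable_const measurable_const

theorem measurable_prod_clash {R : E → E → Prop} (hR : MeasurableSet {p : E × E | R p.1 p.2})
    (s : Finset ι) (x : E) : Measurable fun X : ι → E => ∏ i ∈ s, clash R x (X i) :=
  Finset.measurable_prod _ fun i _ => (measurable_clash hR x).comp (measurable_pi_apply i)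

theorem measurable_sumElim : Measurable fun p : (α → E) × (β → E) => Sum.elim p.1 p.2 := by
  refine measurable_pi_iff.2 ?_
  rintro (i | i)
  · exact (measurable_pi_apply i).comp measurable_fst
  · exact (measurable_pi_apply i).comp measurable_snd

theorem measurable_comp_index (e : α → β) : Measurable fun (X : β → E) (i : α) => X (e i) :=
  measurable_pi_iff.2 fun i => measurable_pi_apply (e i)

/-- A product measure is the joint law of the restrictions to the two parts of the index set. -/
theorem measurePreserving_sumElim_comp (ν : Measure E) [SigmaFinite ν] [Fintype α] [Fintype β]
    [Fintype γ] (e : α ⊕ β ≃ γ) :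
    MeasurePreserving (fun (p : (α → E) × (β → E)) (c : γ) => Sum.elim p.1 p.2 (e.symm c))
      ((Measure.pi fun _ : α => ν).prod (Measure.pi fun _ : β => ν))
      (Measure.pi fun _ : γ => ν) := by
  have h1 := measurePreserving_sumPiEquivProdPi_symm (fun _ : α ⊕ β => ν)
  have h2 := measurePreserving_piCongrLeft (fun _ : γ => ν) e
  have h3 := h2.comp h1
  refine ⟨(measurable_comp_index e.symm).comp measurable_sumElim, ?_⟩
  convert h3.map_eq using 2
  funext p c
  obtain ⟨a, rfl⟩ := e.surjective c
  simp only [Function.comp, MeasurableEquiv.coe_piCongrLeft, Equiv.piCongrLeft_apply_apply,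
    Equiv.symm_apply_apply]
  cases a <;> rfl

theorem integrable_of_bound {ν : Measure E} [IsFiniteMeasure ν] {f : E → ℝ} (hf : Measurable f)
    (C : ℝ) (hC : ∀ x, |f x| ≤ C) : Integrable f ν :=
  Integrable.of_bound hf.aestronglyMeasurable C (Filter.Eventually.of_forall hC)

/-- The integral of `compat` over `p` points that are added to the fixed points `X`. -/
def compatInt (R : E → E → Prop) (ν : Measure E) (X : ι → E) (p : ℕ) : ℝ :=
  ∫ Y : Fin p → E, compat R (Sum.elim X Y) ∂(Measure.pi fun _ => ν)

theorem compatInt_nonneg (R : E → E → Prop) (ν : Measure E) (X : ι → E) (p : ℕ) :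
    0 ≤ compatInt R ν X p := integral_nonneg fun _ => compat_nonneg _ _

/-- No measurability is needed: a non-integrable function has integral `0` by convention, which also
lies in the interval. -/
theorem integral_mem_unit {ν : Measure E} [IsProbabilityMeasure ν] {f : E → ℝ}
    (h : ∀ x, 0 ≤ f x ∧ f x ≤ 1) : 0 ≤ ∫ x, f x ∂ν ∧ ∫ x, f x ∂ν ≤ 1 := by
  refine ⟨integral_nonneg fun x => (h x).1, ?_⟩
  by_cases hf : Integrable f ν
  · simpa using integral_mono hf (integrable_const (1 : ℝ)) fun x => (h x).2
  · rw [integral_undef hf]; norm_num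

theorem compatInt_le_one (R : E → E → Prop) (ν : Measure E) [IsProbabilityMeasure ν] (X : ι → E)
    (p : ℕ) : compatInt R ν X p ≤ 1 :=
  (integral_mem_unit fun _ => ⟨compat_nonneg _ _, compat_le_one _ _⟩).2

theorem measurable_compatInt {R : E → E → Prop} (hR : MeasurableSet {p : E × E | R p.1 p.2})
    (ν : Measure E) [SigmaFinite ν] [Countable ι] (p : ℕ) :
    Measurable fun X : ι → E => compatInt R ν X p :=
  ((measurable_compat hR).comp measurable_sumElim).stronglyMeasurable.integral_prod_right'.measurable

/-- The grand canonical partition function in the presence of the fixed points `X`. -/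
def partition (R : E → E → Prop) (ν : Measure E) (z : ℝ) (X : ι → E) : ℝ :=
  ∑' p : ℕ, z ^ p / (p.factorial : ℝ) * compatInt R ν X p

theorem summable_partition (R : E → E → Prop) (ν : Measure E) [IsProbabilityMeasure ν] {z : ℝ}
    (hz : 0 ≤ z) (X : ι → E) :
    Summable fun p : ℕ => z ^ p / (p.factorial : ℝ) * compatInt R ν X p := by
  refine Summable.of_nonneg_of_le (fun p => mul_nonneg (by positivity) (compatInt_nonneg _ _ _ _))
    (fun p => ?_) (Real.summable_pow_div_factorial z)
  exact mul_le_of_le_one_right (by positivity) (compatInt_le_one _ _ _ _)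

theorem partition_nonneg (R : E → E → Prop) (ν : Measure E) {z : ℝ} (hz : 0 ≤ z) (X : ι → E) :
    0 ≤ partition R ν z X :=
  tsum_nonneg fun p => mul_nonneg (by positivity) (compatInt_nonneg _ _ _ _)

theorem compatInt_comp_equiv (R : E → E → Prop) (ν : Measure E) (X : κ → E) (e : ι ≃ κ) (p : ℕ) :
    compatInt R ν (fun i => X (e i)) p = compatInt R ν X p := by
  unfold compatInt
  congr 1
  funext Y
  rw [← compat_comp_equiv R (Sum.elim X Y) (e.sumCongr (Equiv.refl _))]
  congr 1
  funext i
  cases i <;> rfl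

theorem integrable_compat {R : E → E → Prop} (hR : MeasurableSet {p : E × E | R p.1 p.2})
    (ν : Measure E) [IsProbabilityMeasure ν] [Countable ι] (X : ι → E) {p : ℕ} :
    Integrable (fun Y : Fin p → E => compat R (Sum.elim X Y)) (Measure.pi fun _ => ν) :=
  integrable_of_bound ((measurable_compat hR).comp (measurable_sumElim.comp
    measurable_prodMk_left)) 1 fun Y => by
      rw [abs_of_nonneg (compat_nonneg _ _)]; exact compat_le_one _ _

theorem compatInt_mono {R : E → E → Prop} (hR : MeasurableSet {p : E × E | R p.1 p.2})
    (ν : Measure E) [IsProbabilityMeasure ν] [Countable ι] [Countable κ] (X : κ → E) {e : ι → κ}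
    (he : Function.Injective e) (p : ℕ) :
    compatInt R ν X p ≤ compatInt R ν (fun i => X (e i)) p := by
  refine integral_mono (integrable_compat hR ν X) (integrable_compat hR ν _) fun Y => ?_
  refine (compat_mono R (Sum.elim X Y) (he.sumMap Function.injective_id)).trans_eq ?_
  congr 1
  funext i
  cases i <;> rfl

/-- The correlation function of the points `X`, normalised by the activity. -/
def corr (R : E → E → Prop) (ν : Measure E) (z : ℝ) (X : ι → E) : ℝ :=
  partition R ν z X / partition R ν z (Fin.elim0 : Fin 0 → E)

theorem corr_comp_equiv (R : E → E → Prop) (ν : Measure E) (z : ℝ) (X : κ → E) (e : ι ≃ κ) :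
    corr R ν z (fun i => X (e i)) = corr R ν z X := by
  simp only [corr, partition, compatInt_comp_equiv]

theorem corr_nonneg (R : E → E → Prop) (ν : Measure E) {z : ℝ} (hz : 0 ≤ z) (X : ι → E) :
    0 ≤ corr R ν z X := div_nonneg (partition_nonneg _ _ hz _) (partition_nonneg _ _ hz _)

theorem partition_pos (R : E → E → Prop) (ν : Measure E) [IsProbabilityMeasure ν] {z : ℝ}
    (hz : 0 ≤ z) : 0 < partition R ν z (Fin.elim0 : Fin 0 → E) := by
  refine (summable_partition R ν hz _).tsum_pos
    (fun p => mul_nonneg (by positivity) (compatInt_nonneg _ _ _ _)) 0 ?_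
  have : ∀ Y : Fin 0 → E, compat R (Sum.elim (Fin.elim0 : Fin 0 → E) Y) = 1 := fun Y =>
    if_pos fun i => by rcases i with i | i <;> exact i.elim0
  simp [compatInt, this]

/-- The fixed points add constraints to the free ones, so each term of the numerator is at most the
corresponding term of the denominator. No smallness of `z` is involved. -/
theorem corr_le_one {R : E → E → Prop} (hR : MeasurableSet {p : E × E | R p.1 p.2})
    (ν : Measure E) [IsProbabilityMeasure ν] {z : ℝ} (hz : 0 ≤ z) [Countable ι] (X : ι → E) :
    corr R ν z X ≤ 1 := by
  refine div_le_one_of_le₀ ?_ (partition_nonneg _ _ hz _)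
  refine (summable_partition R ν hz X).tsum_le_tsum (fun p => ?_) (summable_partition R ν hz _)
  refine mul_le_mul_of_nonneg_left ?_ (by positivity)
  refine (compatInt_mono hR ν X (e := (Fin.elim0 : Fin 0 → ι)) (fun i => i.elim0) p).trans_eq ?_
  congr 1
  funext i
  exact i.elim0

theorem corr_of_isEmpty (R : E → E → Prop) (ν : Measure E) [IsProbabilityMeasure ν] {z : ℝ}
    (hz : 0 ≤ z) [IsEmpty ι] (X : ι → E) : corr R ν z X = 1 := by
  rw [← corr_comp_equiv R ν z X (Equiv.equivOfIsEmpty (Fin 0) ι)]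
  rw [show (fun i => X (Equiv.equivOfIsEmpty (Fin 0) ι i)) = Fin.elim0 from
    funext fun i => i.elim0]
  exact div_self (partition_pos R ν hz).ne'

theorem measurable_corr {R : E → E → Prop} (hR : MeasurableSet {p : E × E | R p.1 p.2})
    (ν : Measure E) [SigmaFinite ν] (z : ℝ) [Countable ι] :
    Measurable (corr R ν z : (ι → E) → ℝ) := by
  refine Measurable.div_const ?_ _
  exact Measurable.tsum fun p => (measurable_compatInt hR ν p).const_mul _

end Correlation

/-! ### The Kirkwood-Salsburg equation -/

section KirkwoodSalsburg

variable {E : Type*} [MeasurableSpace E] {ι κ : Type*}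

/-- The integral of `compat` over `k` points that clash with `x` and `q` further points. -/
def clashInt (R : E → E → Prop) (ν : Measure E) (x : E) (X : ι → E) (k q : ℕ) : ℝ :=
  ∫ W : Fin k → E, (∏ i, clash R x (W i)) * compatInt R ν (Sum.elim X W) q ∂(Measure.pi fun _ => ν)

theorem clashInt_mem (R : E → E → Prop) (ν : Measure E) [IsProbabilityMeasure ν] (x : E)
    (X : ι → E) (k q : ℕ) : 0 ≤ clashInt R ν x X k q ∧ clashInt R ν x X k q ≤ 1 :=
  integral_mem_unit fun W => by
    have h := prod_clash_mem R Finset.univ x W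
    exact ⟨mul_nonneg h.1 (compatInt_nonneg _ _ _ _),
      mul_le_one₀ h.2 (compatInt_nonneg _ _ _ _) (compatInt_le_one _ _ _ _)⟩

/-- The integrated points are exchangeable, so only the cardinality of `S` matters: relabel the
points of `S` as the first block and apply Fubini. -/
theorem integral_prod_clash_mul_compat {R : E → E → Prop}
    (hR : MeasurableSet {p : E × E | R p.1 p.2}) (ν : Measure E) [IsProbabilityMeasure ν]
    [Countable ι] (x : E) (X : ι → E) {p k q : ℕ} (S : Finset (Fin p)) (hk : S.card = k)
    (hq : Sᶜ.card = q) :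
    ∫ V : Fin p → E, (∏ j ∈ S, clash R x (V j)) * compat R (Sum.elim X V) ∂(Measure.pi fun _ => ν)
      = clashInt R ν x X k q := by
  set e := finSumEquivOfFinset hk hq
  have hmeas : Measurable fun V : Fin p → E =>
      (∏ j ∈ S, clash R x (V j)) * compat R (Sum.elim X V) :=
    (measurable_prod_clash hR S x).mul ((measurable_compat hR).comp
      (measurable_sumElim.comp measurable_prodMk_left))
  have hmp := measurePreserving_sumElim_comp ν e
  have hprod : ∀ W : Fin k → E, ∀ Y : Fin q → E,
      ∏ j ∈ S, clash R x (Sum.elim W Y (e.symm j)) = ∏ i, clash R x (W i) := fun W Y => by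
    rw [← Finset.prod_coe_sort, ← (S.orderIsoOfFin hk).toEquiv.prod_comp]
    refine Finset.prod_congr rfl fun i _ => ?_
    have : e.symm (S.orderIsoOfFin hk i) = Sum.inl i := by
      rw [Equiv.symm_apply_eq]
      exact (finSumEquivOfFinset_inl hk hq i).symm
    exact congrArg (clash R x) (by
      change Sum.elim W Y (e.symm (S.orderIsoOfFin hk i)) = _
      rw [this]; rfl)
  have hcomp : ∀ W : Fin k → E, ∀ Y : Fin q → E,
      compat R (Sum.elim X fun j => Sum.elim W Y (e.symm j)) =
        compat R (Sum.elim (Sum.elim X W) Y) := fun W Y => by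
    rw [← compat_comp_equiv R (Sum.elim (Sum.elim X W) Y)
      (((Equiv.refl ι).sumCongr e.symm).trans (Equiv.sumAssoc _ _ _).symm)]
    congr 1
    funext i
    rcases i with i | j
    · rfl
    · obtain ⟨a, rfl⟩ := e.surjective j
      rcases a with a | a <;> simp
  rw [← hmp.map_eq, integral_map hmp.measurable.aemeasurable hmeas.aestronglyMeasurable,
    integral_prod]
  · refine integral_congr_ae (Filter.Eventually.of_forall fun W => ?_)
    simp only [hprod, hcomp]
    exact integral_const_mul _ _
  · refine integrable_of_bound (hmeas.comp hmp.measurable) 1 fun V => ?_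
    have h := prod_clash_mem R S x (fun c => Sum.elim V.1 V.2 (e.symm c))
    refine abs_le.2 ⟨neg_one_lt_zero.le.trans (mul_nonneg h.1 (compat_nonneg _ _)), ?_⟩
    exact mul_le_one₀ h.2 (compat_nonneg _ _) (compat_le_one _ _)

theorem compatInt_cons {R : E → E → Prop} (hR : MeasurableSet {p : E × E | R p.1 p.2})
    (hs : ∀ x y, R x y → R y x) (ν : Measure E) [IsProbabilityMeasure ν] [Fintype ι] (x : E)
    (X : ι → E) (p : ℕ) :
    compatInt R ν (Sum.elim (fun _ : Unit => x) X) p =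
      (∏ i, (1 - clash R x (X i))) * ∑ k ∈ Finset.range (p + 1),
        (p.choose k : ℝ) * ((-1) ^ k * clashInt R ν x X k (p - k)) := by
  have h1 : ∀ V : Fin p → E, compat R (Sum.elim (Sum.elim (fun _ : Unit => x) X) V) =
      (∏ i, (1 - clash R x (X i))) * ∑ S ∈ (Finset.univ : Finset (Fin p)).powerset,
        (-1) ^ S.card * ((∏ j ∈ S, clash R x (V j)) * compat R (Sum.elim X V)) := fun V => by
    rw [← compat_comp_equiv R _ (Equiv.sumAssoc _ _ _).symm]
    have : (fun i => Sum.elim (Sum.elim (fun _ : Unit => x) X) V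
        ((Equiv.sumAssoc Unit ι (Fin p)).symm i)) = Sum.elim (fun _ : Unit => x) (Sum.elim X V) := by
      funext i
      rcases i with i | i | i <;> rfl
    rw [this, compat_cons hs, Fintype.prod_sum_type]
    simp only [Sum.elim_inl, Sum.elim_inr]
    have h2 : ∏ j, (1 - clash R x (V j)) = ∑ S ∈ (Finset.univ : Finset (Fin p)).powerset,
        (-1) ^ S.card * ∏ j ∈ S, clash R x (V j) := by
      -- Inclusion-exclusion over the set of points that clash with `x`.
      have := Finset.prod_add_one (f := fun j => -clash R x (V j)) Finset.univ
      simp only [Finset.prod_neg] at this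
      rw [← this]
      exact Finset.prod_congr rfl fun j _ => by ring
    rw [h2, mul_assoc, Finset.sum_mul]
    simp only [mul_assoc]
  unfold compatInt
  simp only [h1]
  rw [integral_const_mul, integral_finsetSum]
  · congr 1
    simp only [integral_const_mul]
    have h3 : ∀ S ∈ (Finset.univ : Finset (Fin p)).powerset,
        ((-1 : ℝ) ^ S.card * ∫ V : Fin p → E, (∏ j ∈ S, clash R x (V j)) * compat R (Sum.elim X V)
          ∂(Measure.pi fun _ => ν)) = (fun k => (-1) ^ k * clashInt R ν x X k (p - k)) S.card :=
      fun S _ => by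
        rw [integral_prod_clash_mul_compat hR ν x X S rfl (q := p - S.card)
          (by rw [Finset.card_compl, Fintype.card_fin])]
    rw [Finset.sum_congr rfl h3,
      Finset.sum_powerset_apply_card (fun k => (-1) ^ k * clashInt R ν x X k (p - k))]
    simp
  · intro S _
    refine Integrable.const_mul (integrable_of_bound ((measurable_prod_clash hR S x).mul
      ((measurable_compat hR).comp (measurable_sumElim.comp measurable_prodMk_left))) 1
      fun V => ?_) _
    have h := prod_clash_mem R S x V
    refine abs_le.2 ⟨neg_one_lt_zero.le.trans (mul_nonneg h.1 (compat_nonneg _ _)), ?_⟩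
    exact mul_le_one₀ h.2 (compat_nonneg _ _) (compat_le_one _ _)

theorem hasSum_integral_prod_clash_mul_partition {R : E → E → Prop}
    (hR : MeasurableSet {p : E × E | R p.1 p.2}) (ν : Measure E) [IsProbabilityMeasure ν]
    [Countable ι] {z : ℝ} (hz : 0 ≤ z) (x : E) (X : ι → E) (k : ℕ) :
    HasSum (fun q : ℕ => z ^ q / (q.factorial : ℝ) * clashInt R ν x X k q)
      (∫ W : Fin k → E, (∏ i, clash R x (W i)) * partition R ν z (Sum.elim X W)
        ∂(Measure.pi fun _ => ν)) := by
  have hb : ∀ q : ℕ, ∀ W : Fin k → E, 0 ≤ z ^ q / (q.factorial : ℝ) *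
      ((∏ i, clash R x (W i)) * compatInt R ν (Sum.elim X W) q) ∧ z ^ q / (q.factorial : ℝ) *
      ((∏ i, clash R x (W i)) * compatInt R ν (Sum.elim X W) q) ≤ z ^ q / (q.factorial : ℝ) :=
    fun q W => by
      have h := prod_clash_mem R Finset.univ x W
      exact ⟨mul_nonneg (by positivity) (mul_nonneg h.1 (compatInt_nonneg _ _ _ _)),
        mul_le_of_le_one_right (by positivity)
          (mul_le_one₀ h.2 (compatInt_nonneg _ _ _ _) (compatInt_le_one _ _ _ _))⟩
  have key := hasSum_integral_of_summable_integral_norm (μ := Measure.pi fun _ : Fin k => ν)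
    (F := fun (q : ℕ) (W : Fin k → E) => z ^ q / (q.factorial : ℝ) *
      ((∏ i, clash R x (W i)) * compatInt R ν (Sum.elim X W) q)) (fun q => ?_) ?_
  · have h1 : ∀ q : ℕ, ∫ W : Fin k → E, z ^ q / (q.factorial : ℝ) *
        ((∏ i, clash R x (W i)) * compatInt R ν (Sum.elim X W) q) ∂(Measure.pi fun _ => ν) =
        z ^ q / (q.factorial : ℝ) * clashInt R ν x X k q := fun q => integral_const_mul _ _
    have h2 : ∫ W : Fin k → E, (∑' q : ℕ, z ^ q / (q.factorial : ℝ) *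
        ((∏ i, clash R x (W i)) * compatInt R ν (Sum.elim X W) q)) ∂(Measure.pi fun _ => ν) =
        ∫ W : Fin k → E, (∏ i, clash R x (W i)) * partition R ν z (Sum.elim X W)
          ∂(Measure.pi fun _ => ν) := by
      refine integral_congr_ae (Filter.Eventually.of_forall fun W => ?_)
      simp only [partition, ← tsum_mul_left]
      exact tsum_congr fun q => by ring
    simpa only [h1, h2] using key
  · refine integrable_of_bound ?_ (z ^ q / (q.factorial : ℝ)) fun W => ?_
    · exact ((measurable_prod_clash hR _ x).mul ((measurable_compatInt hR ν q).comp
        (measurable_sumElim.comp measurable_prodMk_left))).const_mul _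
    · rw [abs_of_nonneg (hb q W).1]; exact (hb q W).2
  · refine Summable.of_nonneg_of_le (fun q => integral_nonneg fun W => norm_nonneg _)
      (fun q => ?_) (Real.summable_pow_div_factorial z)
    simp only [Real.norm_eq_abs, abs_of_nonneg (hb q _).1, integral_const_mul]
    exact mul_le_of_le_one_right (by positivity) (clashInt_mem R ν x X k q).2

/-- The Kirkwood-Salsburg equation. -/
theorem partition_cons {R : E → E → Prop} (hR : MeasurableSet {p : E × E | R p.1 p.2})
    (hs : ∀ x y, R x y → R y x) (ν : Measure E) [IsProbabilityMeasure ν] [Fintype ι] {z : ℝ}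
    (hz : 0 ≤ z) (x : E) (X : ι → E) :
    partition R ν z (Sum.elim (fun _ : Unit => x) X) =
      (∏ i, (1 - clash R x (X i))) * ∑' k : ℕ, (-z) ^ k / (k.factorial : ℝ) *
        ∫ W : Fin k → E, (∏ i, clash R x (W i)) * partition R ν z (Sum.elim X W)
          ∂(Measure.pi fun _ => ν) := by
  set F : ℕ × ℕ → ℝ := fun kq => (-z) ^ kq.1 / (kq.1.factorial : ℝ) *
    (z ^ kq.2 / (kq.2.factorial : ℝ) * clashInt R ν x X kq.1 kq.2) with hF
  -- Absolute convergence of the double series, which permits summation along `p = k + q` to be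
  -- exchanged for iterated summation over `k` and `q`. It is dominated by a product of two
  -- exponential series.
  have hsum : Summable F := by
    refine Summable.of_norm_bounded (g := fun kq : ℕ × ℕ =>
      z ^ kq.1 / (kq.1.factorial : ℝ) * (z ^ kq.2 / (kq.2.factorial : ℝ))) ?_ fun kq => ?_
    · exact (Real.summable_pow_div_factorial z).mul_of_nonneg (Real.summable_pow_div_factorial z)
        (fun _ => by positivity) fun _ => by positivity
    · have h := clashInt_mem R ν x X kq.1 kq.2
      rw [hF, norm_mul, norm_div, norm_pow, norm_neg, norm_mul, Real.norm_of_nonneg hz,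
        Real.norm_of_nonneg h.1, RCLike.norm_natCast,
        Real.norm_of_nonneg (by positivity : 0 ≤ z ^ kq.2 / (kq.2.factorial : ℝ))]
      exact mul_le_mul_of_nonneg_left (mul_le_of_le_one_right (by positivity) h.2) (by positivity)
  have h1 : ∀ p : ℕ, z ^ p / (p.factorial : ℝ) *
      compatInt R ν (Sum.elim (fun _ : Unit => x) X) p =
      (∏ i, (1 - clash R x (X i))) * ∑ kq ∈ Finset.HasAntidiagonal.antidiagonal p, F kq := fun p => by
    rw [compatInt_cons hR hs, Finset.Nat.sum_antidiagonal_eq_sum_range_succ_mk, mul_left_comm]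
    congr 1
    rw [Finset.mul_sum]
    refine Finset.sum_congr rfl fun k hk => ?_
    have hkp : k ≤ p := Nat.lt_succ_iff.1 (Finset.mem_range.1 hk)
    simp only [hF]
    -- The binomial coefficient splits `z ^ p / p!` into the weights of the `k` clashing and the `p
    -- - k` free points.
    rw [Nat.cast_choose ℝ hkp, neg_pow z, ← Nat.add_sub_of_le hkp, pow_add]
    simp only [Nat.add_sub_cancel_left]
    field_simp
  calc partition R ν z (Sum.elim (fun _ : Unit => x) X)
      = (∏ i, (1 - clash R x (X i))) * ∑' p : ℕ, ∑ kq ∈ Finset.HasAntidiagonal.antidiagonal p, F kq := by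
        unfold partition
        simp only [h1, tsum_mul_left]
    _ = (∏ i, (1 - clash R x (X i))) * ∑' kq, F kq := by
        congr 1
        rw [← Finset.HasAntidiagonal.sigmaAntidiagonalEquivProd.tsum_eq F]
        refine Eq.trans ?_ (Summable.tsum_sigma' (fun n => (hasSum_fintype _).summable)
          (Finset.HasAntidiagonal.sigmaAntidiagonalEquivProd.summable_iff.2 hsum)).symm
        refine tsum_congr fun p => ?_
        rw [tsum_fintype, ← Finset.sum_coe_sort]
        rfl
    _ = _ := by
        congr 1
        rw [hsum.tsum_prod]
        refine tsum_congr fun k => ?_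
        simp only [hF, tsum_mul_left,
          (hasSum_integral_prod_clash_mul_partition hR ν hz x X k).tsum_eq]

/-- The right-hand side of the Kirkwood-Salsburg equation for correlation functions. -/
def corrSeries (R : E → E → Prop) (ν : Measure E) (z : ℝ) (x : E) (X : ι → E) : ℝ :=
  ∑' k : ℕ, (-z) ^ k / (k.factorial : ℝ) *
    ∫ W : Fin k → E, (∏ i, clash R x (W i)) * corr R ν z (Sum.elim X W) ∂(Measure.pi fun _ => ν)

theorem corr_cons {R : E → E → Prop} (hR : MeasurableSet {p : E × E | R p.1 p.2})
    (hs : ∀ x y, R x y → R y x) (ν : Measure E) [IsProbabilityMeasure ν] [Fintype ι] {z : ℝ}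
    (hz : 0 ≤ z) (x : E) (X : ι → E) :
    corr R ν z (Sum.elim (fun _ : Unit => x) X) =
      (∏ i, (1 - clash R x (X i))) * corrSeries R ν z x X := by
  simp only [corr, corrSeries, partition_cons hR hs ν hz, mul_div_assoc', integral_div,
    tsum_div_const]

end KirkwoodSalsburg

/-! ### Decay of truncated correlations -/

section Clustering

variable {E : Type*} [MeasurableSpace E] {ι κ : Type*}

theorem integrable_prod_clash_mul_corr {R : E → E → Prop}
    (hR : MeasurableSet {p : E × E | R p.1 p.2}) (ν : Measure E) [IsProbabilityMeasure ν] {z : ℝ}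
    (hz : 0 ≤ z) [Countable ι] (x : E) (X : ι → E) {k : ℕ} :
    Integrable (fun W : Fin k → E => (∏ i, clash R x (W i)) * corr R ν z (Sum.elim X W))
      (Measure.pi fun _ => ν) := by
  refine integrable_of_bound ((measurable_prod_clash hR _ x).mul ((measurable_corr hR ν z).comp
    (measurable_sumElim.comp measurable_prodMk_left))) 1 fun W => ?_
  have h := prod_clash_mem R Finset.univ x W
  refine abs_le.2 ⟨neg_one_lt_zero.le.trans (mul_nonneg h.1 (corr_nonneg _ _ hz _)), ?_⟩
  exact mul_le_one₀ h.2 (corr_nonneg _ _ hz _) (corr_le_one hR _ hz _)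

theorem integral_prod_clash (R : E → E → Prop) (ν : Measure E) [SigmaFinite ν] (x : E) (k : ℕ) :
    ∫ W : Fin k → E, (∏ i, clash R x (W i)) ∂(Measure.pi fun _ => ν) =
      (∫ y, clash R x y ∂ν) ^ k := by
  rw [integral_fintype_prod_eq_prod (fun _ : Fin k => clash R x)]
  simp

/-- Since `corr ≤ 1`, the integral is at most that of the clash product alone, which factorises into
a `k`-th power. -/
theorem abs_corrSeries_term_le {R : E → E → Prop}
    (hR : MeasurableSet {p : E × E | R p.1 p.2}) (ν : Measure E) [IsProbabilityMeasure ν] {z a : ℝ}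
    (hz : 0 ≤ z) (ha : ∀ x, z * ∫ y, clash R x y ∂ν ≤ a) [Countable ι] (x : E) (X : ι → E)
    (k : ℕ) :
    |(-z) ^ k / (k.factorial : ℝ) * ∫ W : Fin k → E, (∏ i, clash R x (W i)) *
      corr R ν z (Sum.elim X W) ∂(Measure.pi fun _ => ν)| ≤ a ^ k / (k.factorial : ℝ) := by
  have h0 : 0 ≤ ∫ W : Fin k → E, (∏ i, clash R x (W i)) *
      corr R ν z (Sum.elim X W) ∂(Measure.pi fun _ => ν) :=
    integral_nonneg fun W => mul_nonneg (prod_clash_mem R _ x W).1 (corr_nonneg _ _ hz _)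
  have h1 : ∫ W : Fin k → E, (∏ i, clash R x (W i)) *
      corr R ν z (Sum.elim X W) ∂(Measure.pi fun _ => ν) ≤ (∫ y, clash R x y ∂ν) ^ k := by
    rw [← integral_prod_clash]
    refine integral_mono (integrable_prod_clash_mul_corr hR ν hz x X)
      (integrable_of_bound (measurable_prod_clash hR _ x) 1 fun W => ?_) fun W => ?_
    · rw [abs_of_nonneg (prod_clash_mem R _ x W).1]; exact (prod_clash_mem R _ x W).2
    · exact mul_le_of_le_one_right (prod_clash_mem R _ x W).1 (corr_le_one hR _ hz _)
  rw [abs_mul, abs_div, abs_pow, abs_neg, abs_of_nonneg hz, abs_of_nonneg h0, Nat.abs_cast,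
    div_mul_eq_mul_div]
  refine div_le_div_of_nonneg_right ?_ (by positivity)
  calc z ^ k * _ ≤ z ^ k * (∫ y, clash R x y ∂ν) ^ k := mul_le_mul_of_nonneg_left h1 (by positivity)
    _ = (z * ∫ y, clash R x y ∂ν) ^ k := (mul_pow _ _ _).symm
    _ ≤ a ^ k := pow_le_pow_left₀ (mul_nonneg hz (integral_nonneg fun y => clash_nonneg R x y))
        (ha x) k

theorem summable_corrSeries {R : E → E → Prop}
    (hR : MeasurableSet {p : E × E | R p.1 p.2}) (ν : Measure E) [IsProbabilityMeasure ν] {z a : ℝ}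
    (hz : 0 ≤ z) (ha : ∀ x, z * ∫ y, clash R x y ∂ν ≤ a) [Countable ι] (x : E) (X : ι → E) :
    Summable fun k : ℕ => (-z) ^ k / (k.factorial : ℝ) * ∫ W : Fin k → E,
      (∏ i, clash R x (W i)) * corr R ν z (Sum.elim X W) ∂(Measure.pi fun _ => ν) :=
  Summable.of_norm_bounded (Real.summable_pow_div_factorial a)
    (abs_corrSeries_term_le hR ν hz ha x X)

theorem abs_corrSeries_le {R : E → E → Prop}
    (hR : MeasurableSet {p : E × E | R p.1 p.2}) (ν : Measure E) [IsProbabilityMeasure ν] {z a : ℝ}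
    (hz : 0 ≤ z) (ha : ∀ x, z * ∫ y, clash R x y ∂ν ≤ a) [Countable ι] (x : E) (X : ι → E) :
    |corrSeries R ν z x X| ≤ Real.exp a := by
  rw [Real.exp_eq_exp_ℝ, NormedSpace.exp_eq_tsum_div, ← Real.norm_eq_abs]
  exact tsum_of_norm_bounded (Real.summable_pow_div_factorial a).hasSum
    (abs_corrSeries_term_le hR ν hz ha x X)

/-- The truncated correlation of two groups of points. -/
def truncCorr (R : E → E → Prop) (ν : Measure E) (z : ℝ) (X : ι → E) (X' : κ → E) : ℝ :=
  corr R ν z (Sum.elim X X') - corr R ν z X * corr R ν z X'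

theorem truncCorr_comp_equiv (R : E → E → Prop) (ν : Measure E) (z : ℝ) {α : Type*} (X : α → E)
    (X' : κ → E) (e : ι ≃ α) :
    truncCorr R ν z (fun i => X (e i)) X' = truncCorr R ν z X X' := by
  unfold truncCorr
  rw [corr_comp_equiv, ← corr_comp_equiv R ν z (Sum.elim X X') (e.sumCongr (Equiv.refl _))]
  congr 2
  funext i
  cases i <;> rfl

theorem abs_truncCorr_le_one {R : E → E → Prop} (hR : MeasurableSet {p : E × E | R p.1 p.2})
    (ν : Measure E) [IsProbabilityMeasure ν] {z : ℝ} (hz : 0 ≤ z) [Countable ι] [Countable κ]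
    (X : ι → E) (X' : κ → E) : |truncCorr R ν z X X'| ≤ 1 := by
  have h1 := corr_nonneg R ν hz (Sum.elim X X')
  have h2 := corr_le_one hR ν hz (Sum.elim X X')
  have h3 := mul_nonneg (corr_nonneg R ν hz X) (corr_nonneg R ν hz X')
  have h4 := mul_le_one₀ (corr_le_one hR ν hz X) (corr_nonneg R ν hz X') (corr_le_one hR ν hz X')
  unfold truncCorr
  exact abs_le.2 ⟨by linarith, by linarith⟩

theorem measurable_truncCorr {R : E → E → Prop} (hR : MeasurableSet {p : E × E | R p.1 p.2})
    (ν : Measure E) [SigmaFinite ν] (z : ℝ) [Countable ι] [Countable κ] :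
    Measurable fun p : (ι → E) × (κ → E) => truncCorr R ν z p.1 p.2 :=
  ((measurable_corr hR ν z).comp measurable_sumElim).sub
    (((measurable_corr hR ν z).comp measurable_fst).mul
      ((measurable_corr hR ν z).comp measurable_snd))

/-- The equation for the joint correlation minus the one for the first group multiplied by `corr
X'`. Both carry the same exclusion factor for `X`; the joint one has an additional factor for `X'`,
and its deviation from `1` is the source term. -/
theorem truncCorr_cons {R : E → E → Prop} (hR : MeasurableSet {p : E × E | R p.1 p.2})
    (hs : ∀ x y, R x y → R y x) (ν : Measure E) [IsProbabilityMeasure ν] [Fintype ι] [Fintype κ]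
    {z a : ℝ} (hz : 0 ≤ z) (ha : ∀ x, z * ∫ y, clash R x y ∂ν ≤ a) (x : E) (X : ι → E)
    (X' : κ → E) :
    truncCorr R ν z (Sum.elim (fun _ : Unit => x) X) X' = (∏ i, (1 - clash R x (X i))) *
      ((∑' k : ℕ, (-z) ^ k / (k.factorial : ℝ) * ∫ W : Fin k → E, (∏ i, clash R x (W i)) *
          truncCorr R ν z (Sum.elim X W) X' ∂(Measure.pi fun _ => ν)) -
        (1 - ∏ j, (1 - clash R x (X' j))) * corrSeries R ν z x (Sum.elim X X')) := by
  have h1 : corr R ν z (Sum.elim (Sum.elim (fun _ : Unit => x) X) X') =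
      corr R ν z (Sum.elim (fun _ : Unit => x) (Sum.elim X X')) := by
    rw [← corr_comp_equiv R ν z _ (Equiv.sumAssoc Unit ι κ)]
    congr 1
    funext i
    rcases i with (i | i) | i <;> rfl
  have h2 : ∀ k : ℕ, ∀ W : Fin k → E, corr R ν z (Sum.elim (Sum.elim X W) X') =
      corr R ν z (Sum.elim (Sum.elim X X') W) := fun k W => by
    rw [← corr_comp_equiv R ν z _ (((Equiv.sumAssoc ι κ (Fin k)).trans
      ((Equiv.refl ι).sumCongr (Equiv.sumComm _ _))).trans (Equiv.sumAssoc ι (Fin k) κ).symm)]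
    congr 1
    funext i
    rcases i with (i | i) | i <;> rfl
  have h3 : (∑' k : ℕ, (-z) ^ k / (k.factorial : ℝ) * ∫ W : Fin k → E, (∏ i, clash R x (W i)) *
      truncCorr R ν z (Sum.elim X W) X' ∂(Measure.pi fun _ => ν)) =
      corrSeries R ν z x (Sum.elim X X') - corrSeries R ν z x X * corr R ν z X' := by
    unfold corrSeries
    rw [← tsum_mul_right, ← Summable.tsum_sub (summable_corrSeries hR ν hz ha x _)
      ((summable_corrSeries hR ν hz ha x X).mul_right _)]
    refine tsum_congr fun k => ?_
    rw [mul_assoc, ← mul_sub, ← integral_mul_const, ← integral_sub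
      (integrable_prod_clash_mul_corr hR ν hz x _)
      ((integrable_prod_clash_mul_corr hR ν hz x X).mul_const _)]
    congr 2
    funext W
    rw [truncCorr, h2]
    ring
  rw [h3, truncCorr, h1, corr_cons hR hs ν hz, corr_cons hR hs ν hz, Fintype.prod_sum_type]
  simp only [Sum.elim_inl, Sum.elim_inr]
  ring

theorem enorm_truncCorr_cons_le {R : E → E → Prop} (hR : MeasurableSet {p : E × E | R p.1 p.2})
    (hs : ∀ x y, R x y → R y x) (ν : Measure E) [IsProbabilityMeasure ν] [Fintype ι] [Fintype κ]
    {z a : ℝ} (hz : 0 ≤ z) (ha : ∀ x, z * ∫ y, clash R x y ∂ν ≤ a) (x : E) (X : ι → E)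
    (X' : κ → E) :
    ‖truncCorr R ν z (Sum.elim (fun _ : Unit => x) X) X'‖ₑ ≤
      (∑' k : ℕ, ENNReal.ofReal (z ^ k / (k.factorial : ℝ)) * ∫⁻ W : Fin k → E,
        ENNReal.ofReal (∏ i, clash R x (W i)) * ‖truncCorr R ν z (Sum.elim X W) X'‖ₑ
          ∂(Measure.pi fun _ => ν)) +
      ENNReal.ofReal (Real.exp a) * ∑ j, ENNReal.ofReal (clash R x (X' j)) := by
  rw [truncCorr_cons hR hs ν hz ha, enorm_mul]
  have h1 := prod_one_sub_clash_mem R x X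
  refine (mul_le_of_le_one_left' ?_).trans ((enorm_sub_le).trans (add_le_add ?_ ?_))
  · rw [Real.enorm_of_nonneg h1.1]
    exact ENNReal.ofReal_le_one.2 h1.2
  · refine enorm_tsum_le_tsum_enorm.trans (ENNReal.tsum_le_tsum fun k => ?_)
    rw [enorm_mul]
    refine mul_le_mul' (le_of_eq ?_) ((enorm_integral_le_lintegral_enorm _).trans_eq
      (lintegral_congr fun W => ?_))
    · rw [Real.enorm_eq_ofReal_abs, abs_div, abs_pow, abs_neg, abs_of_nonneg hz, Nat.abs_cast]
    · rw [enorm_mul, Real.enorm_of_nonneg (prod_clash_mem R _ x W).1]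
  · have h2 := prod_one_sub_clash_mem R x X'
    rw [enorm_mul, mul_comm, Real.enorm_of_nonneg (sub_nonneg.2 h2.2), Real.enorm_eq_ofReal_abs,
      ← ENNReal.ofReal_sum_of_nonneg fun j _ => clash_nonneg R x _]
    exact mul_le_mul' (ENNReal.ofReal_le_ofReal (abs_corrSeries_le hR ν hz ha x _))
      (ENNReal.ofReal_le_ofReal (one_sub_prod_clash_le R x X'))

theorem lintegral_prod_clash {R : E → E → Prop} (hR : MeasurableSet {p : E × E | R p.1 p.2})
    (ν : Measure E) [IsProbabilityMeasure ν] (x : E) (k : ℕ) :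
    ∫⁻ W : Fin k → E, ENNReal.ofReal (∏ i, clash R x (W i)) ∂(Measure.pi fun _ => ν) =
      ENNReal.ofReal ((∫ y, clash R x y ∂ν) ^ k) := by
  rw [← integral_prod_clash, ofReal_integral_eq_lintegral_ofReal
    (integrable_of_bound (measurable_prod_clash hR _ x) 1 fun W => ?_)
    (Filter.Eventually.of_forall fun W => (prod_clash_mem R _ x W).1)]
  rw [abs_of_nonneg (prod_clash_mem R _ x W).1]; exact (prod_clash_mem R _ x W).2

variable {T : Type*} [MeasurableSpace T]

/-- One iteration step. The hypothesis allows growth by a factor `2` for each added point, which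
turns the series in `a ^ k / k!` into `exp (2 * a)`. The source is controlled by a union bound over
the points of `X'`, each of which meets `x` with probability at most `b` under `τ`. -/
theorem lintegral_truncCorr_cons_le {R : E → E → Prop}
    (hR : MeasurableSet {p : E × E | R p.1 p.2})
    (hs : ∀ x y, R x y → R y x) (ν : Measure E) [IsProbabilityMeasure ν] [Fintype ι] [Fintype κ]
    {z a b : ℝ} (hz : 0 ≤ z) (ha : ∀ x, z * ∫ y, clash R x y ∂ν ≤ a) (hb : 0 ≤ b)
    (τ : Measure T) [IsProbabilityMeasure τ] {X' : T → κ → E} (hX' : Measurable X')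
    (hXb : ∀ x j, ∫⁻ t, ENNReal.ofReal (clash R x (X' t j)) ∂τ ≤ ENNReal.ofReal b)
    (x : E) (X : ι → E) {B : ℝ} (hB : 0 ≤ B)
    (h : ∀ (k : ℕ) (W : Fin k → E), ∫⁻ t, ‖truncCorr R ν z (Sum.elim X W) (X' t)‖ₑ ∂τ ≤
      ENNReal.ofReal (B * 2 ^ k)) :
    ∫⁻ t, ‖truncCorr R ν z (Sum.elim (fun _ : Unit => x) X) (X' t)‖ₑ ∂τ ≤
      ENNReal.ofReal (B * Real.exp (2 * a) + Real.exp a * (Fintype.card κ * b)) := by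
  have ha0 : 0 ≤ a := (mul_nonneg hz (integral_nonneg fun y => clash_nonneg R x y)).trans (ha x)
  have hm : ∀ k : ℕ, Measurable fun p : T × (Fin k → E) => ENNReal.ofReal
      (∏ i, clash R x (p.2 i)) * ‖truncCorr R ν z (Sum.elim X p.2) (X' p.1)‖ₑ := fun k => by
    refine (((measurable_prod_clash hR _ x).comp measurable_snd).ennreal_ofReal).mul
      (Measurable.enorm ?_)
    exact (measurable_truncCorr hR ν z).comp (((measurable_sumElim.comp
      measurable_prodMk_left).comp measurable_snd).prodMk (hX'.comp measurable_fst))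
  have hm2 : ∀ j, Measurable fun t => ENNReal.ofReal (clash R x (X' t j)) := fun j =>
    ((measurable_clash hR x).comp ((measurable_pi_apply j).comp hX')).ennreal_ofReal
  refine (lintegral_mono fun t => enorm_truncCorr_cons_le hR hs ν hz ha x X (X' t)).trans ?_
  rw [lintegral_add_right _ ((Finset.measurable_sum _ fun j _ => hm2 j).const_mul _),
    ENNReal.ofReal_add (by positivity) (by positivity), lintegral_tsum fun k =>
      ((hm k).lintegral_prod_right'.const_mul _).aemeasurable]
  refine add_le_add ?_ ?_
  · have hexp : HasSum (fun k : ℕ => B * ((2 * a) ^ k / (k.factorial : ℝ)))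
        (B * Real.exp (2 * a)) := by
      rw [Real.exp_eq_exp_ℝ]
      exact (NormedSpace.expSeries_div_hasSum_exp (2 * a)).mul_left B
    rw [← hexp.tsum_eq, ENNReal.ofReal_tsum_of_nonneg (fun k => by positivity) hexp.summable]
    refine ENNReal.tsum_le_tsum fun k => ?_
    rw [lintegral_const_mul _ (hm k).lintegral_prod_right', lintegral_lintegral_swap
      (hm k).aemeasurable]
    have hW : ∀ W : Fin k → E, ∫⁻ t, ENNReal.ofReal (∏ i, clash R x (W i)) *
        ‖truncCorr R ν z (Sum.elim X W) (X' t)‖ₑ ∂τ ≤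
        ENNReal.ofReal (∏ i, clash R x (W i)) * ENNReal.ofReal (B * 2 ^ k) := fun W => by
      rw [lintegral_const_mul' _ _ ENNReal.ofReal_ne_top]
      exact mul_le_mul_right (h k W) _
    refine (mul_le_mul_right (lintegral_mono hW) _).trans ?_
    rw [lintegral_mul_const' _ _ ENNReal.ofReal_ne_top, lintegral_prod_clash hR,
      ← ENNReal.ofReal_mul (by exact pow_nonneg (integral_nonneg fun y => clash_nonneg R x y) k),
      ← ENNReal.ofReal_mul (by positivity)]
    refine ENNReal.ofReal_le_ofReal ?_
    have h4 : z ^ k * (∫ y, clash R x y ∂ν) ^ k ≤ a ^ k := by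
      rw [← mul_pow]
      exact pow_le_pow_left₀ (mul_nonneg hz (integral_nonneg fun y => clash_nonneg R x y)) (ha x) k
    calc z ^ k / (k.factorial : ℝ) * ((∫ y, clash R x y ∂ν) ^ k * (B * 2 ^ k))
        = (z ^ k * (∫ y, clash R x y ∂ν) ^ k) * (B * 2 ^ k / (k.factorial : ℝ)) := by ring
      _ ≤ a ^ k * (B * 2 ^ k / (k.factorial : ℝ)) :=
        mul_le_mul_of_nonneg_right h4 (by positivity)
      _ = B * ((2 * a) ^ k / (k.factorial : ℝ)) := by rw [mul_pow]; ring
  · rw [lintegral_const_mul _ (Finset.measurable_sum _ fun j _ => hm2 j),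
      lintegral_finsetSum _ fun j _ => hm2 j, ENNReal.ofReal_mul (Real.exp_pos _).le]
    refine mul_le_mul_right ((Finset.sum_le_sum fun j _ => hXb x j).trans_eq ?_) _
    rw [Finset.sum_const, nsmul_eq_mul, ENNReal.ofReal_mul (by positivity),
      ENNReal.ofReal_natCast, Finset.card_univ]

/-- Integrated decay of the truncated correlations at low density. -/
theorem lintegral_truncCorr_le {ι : Type} {R : E → E → Prop}
    (hR : MeasurableSet {p : E × E | R p.1 p.2})
    (hs : ∀ x y, R x y → R y x) (ν : Measure E) [IsProbabilityMeasure ν] [Fintype ι] [Fintype κ]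
    {z a b : ℝ} (hz : 0 ≤ z) (ha : ∀ x, z * ∫ y, clash R x y ∂ν ≤ a) (ha' : a ≤ 1 / 8)
    (hb : 0 ≤ b) (τ : Measure T) [IsProbabilityMeasure τ] {X' : T → κ → E} (hX' : Measurable X')
    (hXb : ∀ x j, ∫⁻ t, ENNReal.ofReal (clash R x (X' t j)) ∂τ ≤ ENNReal.ofReal b) (X : ι → E) :
    ∫⁻ t, ‖truncCorr R ν z X (X' t)‖ₑ ∂τ ≤
      ENNReal.ofReal (4 * (Fintype.card κ * b) * 2 ^ Fintype.card ι) := by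
  -- From `exp x ≤ 1 / (1 - x)` at `x = 1 / 4`, whose value is `4 / 3`.
  have hexp : Real.exp (2 * a) ≤ 3 / 2 := by
    have h1 := Real.exp_bound_div_one_sub_of_interval (x := 1 / 4) (by norm_num) (by norm_num)
    exact (Real.exp_le_exp.2 (by linarith)).trans (h1.trans (by norm_num))
  have hexp1 : Real.exp a ≤ 2 := by
    have h1 := Real.exp_bound_div_one_sub_of_interval (x := 1 / 4) (by norm_num) (by norm_num)
    exact (Real.exp_le_exp.2 (by linarith)).trans (h1.trans (by norm_num))
  set A : ℝ := 4 * (Fintype.card κ * b) with hA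
  have hA0 : 0 ≤ A := by positivity
  -- After `j` iterations the initial bound `1` has shrunk to `(3 / 4) ^ j` in the weighted norm,
  -- while the accumulated sources stay below `A`. The index type varies because each step replaces
  -- one point by `k` others.
  have key : ∀ (j : ℕ) (ι : Type) [Fintype ι] (X : ι → E),
      ∫⁻ t, ‖truncCorr R ν z X (X' t)‖ₑ ∂τ ≤
        ENNReal.ofReal ((A + (3 / 4) ^ j) * 2 ^ Fintype.card ι) := by
    intro j
    induction j with
    | zero =>
      intro ι _ X
      have h1 : ∀ t, ‖truncCorr R ν z X (X' t)‖ₑ ≤ 1 := fun t => by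
        rw [Real.enorm_eq_ofReal_abs]
        exact ENNReal.ofReal_le_one.2 (abs_truncCorr_le_one hR ν hz X (X' t))
      refine (lintegral_mono h1).trans ?_
      rw [lintegral_one, measure_univ, ENNReal.one_le_ofReal]
      exact one_le_mul_of_one_le_of_one_le (by simpa using hA0) (one_le_pow₀ (by norm_num))
    | succ j ih =>
      intro ι _ X
      rcases hn : Fintype.card ι with _ | n
      -- With no point to remove there is no recursion, but the truncated correlation with an empty
      -- group vanishes.
      · have : IsEmpty ι := Fintype.card_eq_zero_iff.1 hn
        have h0 : ∀ t, truncCorr R ν z X (X' t) = 0 := fun t => by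
          rw [truncCorr, corr_of_isEmpty R ν hz X,
            ← corr_comp_equiv R ν z (Sum.elim X (X' t)) (Equiv.emptySum ι κ).symm]
          simp
        simp [h0]
      · have e : Unit ⊕ Fin n ≃ ι := Fintype.equivOfCardEq (by simp [hn, add_comm])
        have hX : (fun i => X (e i)) =
            Sum.elim (fun _ : Unit => X (e (Sum.inl ()))) fun i => X (e (Sum.inr i)) := by
          funext i
          rcases i with i | i <;> rfl
        have h1 := lintegral_truncCorr_cons_le hR hs ν hz ha hb τ hX' hXb (X (e (Sum.inl ())))
          (fun i => X (e (Sum.inr i))) (B := (A + (3 / 4) ^ j) * 2 ^ n) (by positivity)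
          fun k W => by
            refine (ih (Fin n ⊕ Fin k) _).trans_eq ?_
            rw [Fintype.card_sum, Fintype.card_fin, Fintype.card_fin, pow_add, mul_assoc]
        rw [← hX] at h1
        simp only [truncCorr_comp_equiv] at h1
        refine h1.trans (ENNReal.ofReal_le_ofReal ?_)
        -- The factor `3 / 2` is `3 / 4` of the weight `2` of the removed point. The source is at
        -- most `A / 2`, and `(3 / 2) * A * 2 ^ n + A / 2 ≤ A * 2 ^ (n + 1)`; this fixes the
        -- constant `4` in `A`.
        have h2 : (1 : ℝ) ≤ 2 ^ n := one_le_pow₀ (by norm_num)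
        have h3 : (A + (3 / 4) ^ j) * 2 ^ n * Real.exp (2 * a) ≤
            (A + (3 / 4) ^ j) * 2 ^ n * (3 / 2) := mul_le_mul_of_nonneg_left hexp (by positivity)
        have h4 : Real.exp a * (Fintype.card κ * b) ≤ 2 * (Fintype.card κ * b) :=
          mul_le_mul_of_nonneg_right hexp1 (by positivity)
        have h5 : A ≤ A * 2 ^ n := le_mul_of_one_le_right hA0 h2
        rw [pow_succ, pow_succ]
        linarith
  refine ge_of_tendsto' (x := Filter.atTop) (ENNReal.tendsto_ofReal ?_) fun j => key j ι X
  have h1 : Filter.Tendsto (fun j : ℕ => ((3 : ℝ) / 4) ^ j) Filter.atTop (nhds 0) :=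
    tendsto_pow_atTop_nhds_zero_of_lt_one (by norm_num) (by norm_num)
  simpa using (h1.const_add A).mul_const (2 ^ Fintype.card ι)

end Clustering

/-! ### From sums over tuples of particles to correlation functions -/

section Reduction

theorem exists_equiv_extending {α γ : Type*} [Fintype α] [Fintype γ] {p : ℕ} (k : α ↪ γ)
    (h : Fintype.card γ = Fintype.card α + p) :
    ∃ e : α ⊕ Fin p ≃ γ, ∀ i, e (Sum.inl i) = k i := by
  classical
  have hc : Fintype.card (Fin p) = Fintype.card ((Set.range k)ᶜ : Set γ) := by
    rw [Fintype.card_compl_set, Set.card_range_of_injective k.injective, h, Fintype.card_fin]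
    omega
  exact ⟨((Equiv.ofInjective k k.injective).sumCongr (Fintype.equivOfCardEq hc)).trans
    (Equiv.Set.sumCompl (Set.range k)), fun i => by simp⟩

variable {E : Type*} [MeasurableSpace E]

/-- By exchangeability every choice of the `n` observed particles contributes the same; the other
`p` are integrated out. -/
theorem lintegral_compat_mul_comp {R : E → E → Prop} (hR : MeasurableSet {p : E × E | R p.1 p.2})
    (ν : Measure E) [IsProbabilityMeasure ν] {n p : ℕ} {γ : Type*} [Fintype γ]
    (h : Fintype.card γ = n + p) (k : Fin n ↪ γ) {F : (Fin n → E) → ℝ≥0∞} (hF : Measurable F) :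
    ∫⁻ Z : γ → E, ENNReal.ofReal (compat R Z) * F (fun i => Z (k i)) ∂(Measure.pi fun _ => ν) =
      ∫⁻ X, F X * ENNReal.ofReal (compatInt R ν X p) ∂(Measure.pi fun _ => ν) := by
  obtain ⟨e, he⟩ := exists_equiv_extending k (p := p) (by rw [h, Fintype.card_fin])
  have hmp := measurePreserving_sumElim_comp ν e
  have hm : Measurable fun Z : γ → E => ENNReal.ofReal (compat R Z) * F (fun i => Z (k i)) :=
    (measurable_compat hR).ennreal_ofReal.mul (hF.comp (measurable_comp_index k))
  rw [← hmp.map_eq, lintegral_map hm hmp.measurable,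
    lintegral_prod _ (by exact (hm.comp hmp.measurable).aemeasurable)]
  refine lintegral_congr fun X => ?_
  have h1 : ∀ Y : Fin p → E, (fun i => Sum.elim X Y (e.symm (k i))) = X := fun Y => by
    funext i
    rw [← he, Equiv.symm_apply_apply, Sum.elim_inl]
  have h2 : ∀ Y : Fin p → E, compat R (fun c => Sum.elim X Y (e.symm c)) =
      compat R (Sum.elim X Y) := fun Y => compat_comp_equiv R _ e.symm
  simp only [h1, h2]
  have h3 : Measurable fun Y : Fin p → E => ENNReal.ofReal (compat R (Sum.elim X Y)) :=
    ((measurable_compat hR).comp (measurable_sumElim.comp measurable_prodMk_left)).ennreal_ofReal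
  rw [lintegral_mul_const _ h3, mul_comm, compatInt,
    ofReal_integral_eq_lintegral_ofReal (integrable_compat hR ν X)
      (Filter.Eventually.of_forall fun _ => compat_nonneg _ _)]

/-- There are `N! / (N - n)!` embeddings, which turns `z ^ N / N!` into `z ^ n` times the weight `z
^ p / p!` of the `p = N - n` remaining particles. -/
theorem tsum_lintegral_compat_mul_sum {R : E → E → Prop}
    (hR : MeasurableSet {p : E × E | R p.1 p.2}) (ν : Measure E) [IsProbabilityMeasure ν]
    {z : ℝ} (hz : 0 ≤ z) {n : ℕ} {F : (Fin n → E) → ℝ≥0∞} (hF : Measurable F) :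
    ∑' N : ℕ, ENNReal.ofReal (z ^ N / (N.factorial : ℝ)) *
      ∫⁻ Z : Fin N → E, ENNReal.ofReal (compat R Z) * ∑ k : Fin n ↪ Fin N, F (fun i => Z (k i))
        ∂(Measure.pi fun _ => ν) =
      ENNReal.ofReal (z ^ n) * ∫⁻ X, F X * ENNReal.ofReal (partition R ν z X)
        ∂(Measure.pi fun _ => ν) := by
  set f : ℕ → ℝ≥0∞ := fun N => ENNReal.ofReal (z ^ N / (N.factorial : ℝ)) *
      ∫⁻ Z : Fin N → E, ENNReal.ofReal (compat R Z) * ∑ k : Fin n ↪ Fin N, F (fun i => Z (k i))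
        ∂(Measure.pi fun _ => ν) with hf
  have hsmall : ∀ N, N < n → f N = 0 := fun N hN => by
    have : IsEmpty (Fin n ↪ Fin N) := ⟨fun k => by
      have := Fintype.card_le_of_embedding k
      simp only [Fintype.card_fin] at this
      omega⟩
    simp [hf]
  have hlarge : ∀ p, f (n + p) = ENNReal.ofReal (z ^ n) * (ENNReal.ofReal (z ^ p /
      (p.factorial : ℝ)) * ∫⁻ X, F X * ENNReal.ofReal (compatInt R ν X p)
        ∂(Measure.pi fun _ => ν)) := fun p => by
    have hk : ∀ k : Fin n ↪ Fin (n + p), Measurable fun Z : Fin (n + p) → E =>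
        ENNReal.ofReal (compat R Z) * F (fun i => Z (k i)) := fun k =>
      (measurable_compat hR).ennreal_ofReal.mul (hF.comp (measurable_comp_index k))
    simp only [hf, Finset.mul_sum]
    rw [lintegral_finsetSum _ fun k _ => hk k]
    simp only [lintegral_compat_mul_comp hR ν (Fintype.card_fin (n + p)) _ hF]
    rw [Finset.sum_const, nsmul_eq_mul, Finset.card_univ, Fintype.card_embedding_eq,
      Fintype.card_fin, Fintype.card_fin, ← mul_assoc, ← mul_assoc,
      ← ENNReal.ofReal_mul (by positivity), ← ENNReal.ofReal_natCast,
      ← ENNReal.ofReal_mul (by positivity)]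
    congr 2
    have h1 : ((n + p).factorial : ℝ) = p.factorial * ((n + p).descFactorial n : ℝ) := by
      have := Nat.factorial_mul_descFactorial (Nat.le_add_right n p)
      rw [Nat.add_sub_cancel_left] at this
      exact_mod_cast this.symm
    have h2 : ((n + p).descFactorial n : ℝ) ≠ 0 := by
      exact_mod_cast (Nat.descFactorial_pos.2 (Nat.le_add_right n p)).ne'
    rw [h1, pow_add]
    field_simp
  have hsum : ∑' N, f N = ∑' p, f (n + p) :=
    ((add_right_injective n).tsum_eq (f := f) fun N hN => by
      by_contra h
      refine hN (hsmall N ?_)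
      by_contra h'
      exact h ⟨N - n, by simp only; omega⟩).symm
  rw [hsum]
  simp only [hlarge]
  rw [ENNReal.tsum_mul_left]
  congr 1
  have hm : ∀ p, Measurable fun X : Fin n → E => F X * ENNReal.ofReal (compatInt R ν X p) :=
    fun p => hF.mul (measurable_compatInt hR ν p).ennreal_ofReal
  simp only [← lintegral_const_mul _ (hm _)]
  rw [← lintegral_tsum fun p => ((hm p).const_mul _).aemeasurable]
  refine lintegral_congr fun X => ?_
  rw [partition, ENNReal.ofReal_tsum_of_nonneg
    (fun p => mul_nonneg (by positivity) (compatInt_nonneg _ _ _ _))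
    (summable_partition R ν hz X), ← ENNReal.tsum_mul_left]
  refine tsum_congr fun p => ?_
  rw [ENNReal.ofReal_mul (by positivity)]
  ring

end Reduction

/-! ### The hard sphere Gibbs measure -/

section Gibbs

variable {d n : ℕ}

/-- The reference probability measure of one particle. -/
abbrev particle (d : ℕ) : Measure (Phase d) := (volume : Measure (Torus d)).prod (maxwellMeasure d)

/-- Two particles do not overlap. -/
def Apart (d : ℕ) (ε : ℝ) (z w : Phase d) : Prop := ε < torusDist z.1 w.1

theorem measurable_torusDist {α : Type*} [MeasurableSpace α] {f g : α → Torus d}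
    (hf : Measurable f) (hg : Measurable g) : Measurable fun p => torusDist (f p) (g p) := by
  have h : Measurable fun q : UnitAddCircle × UnitAddCircle => ‖q.1 - q.2‖ := by
    have h' : Continuous fun q : UnitAddCircle × UnitAddCircle => ‖q.1 - q.2‖ := by fun_prop
    exact h'.measurable
  unfold torusDist
  refine Real.continuous_sqrt.measurable.comp (Finset.measurable_sum _ fun k _ => ?_)
  have hf' : Measurable fun p => f p k := by fun_prop
  have hg' : Measurable fun p => g p k := by fun_prop
  exact (h.comp (hf'.prodMk hg')).pow_const 2

theorem measurableSet_apart (d : ℕ) (ε : ℝ) :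
    MeasurableSet {p : Phase d × Phase d | Apart d ε p.1 p.2} := by
  have hf : Measurable fun p : Phase d × Phase d => p.1.1 := by fun_prop
  have hg : Measurable fun p : Phase d × Phase d => p.2.1 := by fun_prop
  exact measurableSet_lt measurable_const (measurable_torusDist hf hg)

theorem Apart.symm {ε : ℝ} (z w : Phase d) (h : Apart d ε z w) : Apart d ε w z := by
  have : torusDist w.1 z.1 = torusDist z.1 w.1 := by
    simp only [torusDist, norm_sub_rev]
  exact h.trans_eq this.symm

instance isProbabilityMeasure_unitAddCircle :
    IsProbabilityMeasure (volume : Measure UnitAddCircle) := ⟨by simp⟩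

instance isProbabilityMeasure_maxwellMeasure (d : ℕ) :
    IsProbabilityMeasure (maxwellMeasure d) := by
  have h1 : ∫ v : Vel d, maxwellian v = 1 := by
    have h := GaussianFourier.integral_rexp_neg_mul_sq_norm (V := Vel d) (b := 1 / 2) (by norm_num)
    simp only [maxwellian, integral_const_mul]
    have h2 : ∀ v : Vel d, -‖v‖ ^ 2 / 2 = -(1 / 2) * ‖v‖ ^ 2 := fun v => by ring
    simp only [h2, h, finrank_euclideanSpace_fin]
    rw [show Real.pi / (1 / 2) = 2 * Real.pi by ring, ← Real.rpow_add (by positivity)]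
    rw [neg_div, neg_add_cancel, Real.rpow_zero]
  refine ⟨?_⟩
  rw [maxwellMeasure, withDensity_apply _ MeasurableSet.univ, setLIntegral_univ,
    -- Integrability comes for free: a non-integrable Maxwellian would have integral `0` instead of
    -- `1`.
    ← ofReal_integral_eq_lintegral_ofReal (by
      by_contra h
      rw [integral_undef h] at h1
      norm_num at h1) (Filter.Eventually.of_forall fun v => by
        simp only [maxwellian]; positivity), h1, ENNReal.ofReal_one]

instance isProbabilityMeasure_particle (d : ℕ) : IsProbabilityMeasure (particle d) :=
  inferInstance

instance isProbabilityMeasure_refMeasure (d n : ℕ) : IsProbabilityMeasure (refMeasure d n) :=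
  inferInstanceAs (IsProbabilityMeasure (Measure.pi fun _ => particle d))

theorem measurable_config {β : Type*} [MeasurableSpace β] {G : Config d → β}
    (h : ∀ N, Measurable fun Z : Fin N → Phase d => G ⟨N, Z⟩) : Measurable G := by
  intro s hs
  refine MeasurableSpace.measurableSet_iInf.2 fun N => ?_
  exact h N hs

theorem ofReal_compat_apart (ε : ℝ) {N : ℕ} (Z : Fin N → Phase d) :
    ENNReal.ofReal (compat (Apart d ε) Z) = (hardCore d ε N).indicator 1 Z := by
  classical
  rw [compat, Set.indicator_apply]
  split_ifs with h1 h2 h2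
  · simp
  · exact absurd h1 h2
  · exact absurd h2 h1
  · simp

theorem measurableSet_hardCore (d : ℕ) (ε : ℝ) (N : ℕ) : MeasurableSet (hardCore d ε N) := by
  have h := (measurable_compat (ι := Fin N) (measurableSet_apart d ε)).ennreal_ofReal
    (measurableSet_singleton 1)
  convert h using 1
  ext Z
  simp only [Set.mem_preimage, ofReal_compat_apart, Set.mem_singleton_iff]
  by_cases hZ : Z ∈ hardCore d ε N <;> simp [hZ]

theorem lintegral_gibbsWeight (d : ℕ) (ε : ℝ) {G : Config d → ℝ≥0∞} (hG : Measurable G) :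
    ∫⁻ ω, G ω ∂(gibbsWeight d ε) = ∑' N : ℕ,
      ENNReal.ofReal (activity d ε ^ N / (N.factorial : ℝ)) *
      ∫⁻ Z : Fin N → Phase d, ENNReal.ofReal (compat (Apart d ε) Z) * G ⟨N, Z⟩
        ∂(Measure.pi fun _ => particle d) := by
  have hmk : ∀ N : ℕ, Measurable fun Z : Fin N → Phase d => (⟨N, Z⟩ : Config d) := fun N => by
    intro s hs
    exact MeasurableSpace.measurableSet_iInf.1 hs N
  rw [gibbsWeight, lintegral_sum_measure]
  refine tsum_congr fun N => ?_
  rw [lintegral_smul_measure, lintegral_map hG (hmk N),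
    ← lintegral_indicator (measurableSet_hardCore d ε N), smul_eq_mul]
  congr 1
  refine lintegral_congr fun Z => ?_
  rw [ofReal_compat_apart]
  by_cases hZ : Z ∈ hardCore d ε N <;> simp [hZ]

theorem activity_pos (d : ℕ) {ε : ℝ} (hε : 0 < ε) : 0 < activity d ε := by
  unfold activity; positivity

theorem measurable_sum_embedding {β : Type*} [AddCommMonoid β] [MeasurableSpace β]
    [MeasurableAdd₂ β] {F : (Fin n → Phase d) → β} (hF : Measurable F) :
    Measurable fun ω : Config d => ∑ k : Fin n ↪ Fin ω.1, F fun i => ω.2 (k i) := by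
  refine measurable_config fun N => ?_
  have h : ∀ k : Fin n ↪ Fin N, Measurable fun Z : Fin N → Phase d => F fun i => Z (k i) :=
    fun k => hF.comp (measurable_comp_index k)
  change Measurable fun Z : Fin N → Phase d => ∑ k : Fin n ↪ Fin N, F fun i => Z (k i)
  exact Finset.measurable_sum _ fun k _ => h k

/-- The partition function of the hard sphere gas. -/
theorem gibbsWeight_univ (d : ℕ) {ε : ℝ} (hε : 0 < ε) : gibbsWeight d ε Set.univ =
    ENNReal.ofReal (partition (Apart d ε) (particle d) (activity d ε)
      (Fin.elim0 : Fin 0 → Phase d)) := by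
  have h := tsum_lintegral_compat_mul_sum (measurableSet_apart d ε) (particle d)
    (activity_pos d hε).le (n := 0) (F := fun _ => 1) measurable_const
  rw [← lintegral_gibbsWeight d ε (G := fun ω => ∑ k : Fin 0 ↪ Fin ω.1, 1)
    (measurable_sum_embedding (F := fun _ => 1) measurable_const)] at h
  have h1 : ∀ X : Fin 0 → Phase d, X = Fin.elim0 := fun X => funext fun i => i.elim0
  simp only [h1] at h
  simpa using h

/-- The correlation functions describe the expectations of sums over distinct particles. -/
theorem lintegral_gibbs_sum {ε : ℝ} (hε : 0 < ε) {F : (Fin n → Phase d) → ℝ≥0∞}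
    (hF : Measurable F) :
    ∫⁻ ω, ∑ k : Fin n ↪ Fin ω.1, F (fun i => ω.2 (k i)) ∂(gibbs d ε) =
      ENNReal.ofReal (activity d ε ^ n) * ∫⁻ X, F X *
        ENNReal.ofReal (corr (Apart d ε) (particle d) (activity d ε) X) ∂(refMeasure d n) := by
  have hz := activity_pos d hε
  have hpos := partition_pos (Apart d ε) (particle d) hz.le
  rw [gibbs, lintegral_smul_measure, lintegral_gibbsWeight d ε (measurable_sum_embedding hF),
    tsum_lintegral_compat_mul_sum (measurableSet_apart d ε) (particle d) hz.le hF,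
    gibbsWeight_univ d hε, smul_eq_mul, mul_left_comm]
  congr 1
  rw [← lintegral_const_mul' _ _ (ENNReal.inv_ne_top.2 (ENNReal.ofReal_pos.2 hpos).ne')]
  refine lintegral_congr fun X => ?_
  rw [corr, ENNReal.ofReal_div_of_pos hpos, div_eq_mul_inv]
  ring

theorem isProbabilityMeasure_gibbs (d : ℕ) {ε : ℝ} (hε : 0 < ε) :
    IsProbabilityMeasure (gibbs d ε) := by
  have hpos := partition_pos (Apart d ε) (particle d) (activity_pos d hε).le
  refine ⟨?_⟩
  rw [gibbs, Measure.smul_apply, smul_eq_mul, gibbsWeight_univ d hε,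
    ENNReal.inv_mul_cancel (ENNReal.ofReal_pos.2 hpos).ne' ENNReal.ofReal_ne_top]

theorem measurable_empirical (ε : ℝ) {g : (Fin n → Phase d) → ℝ} (hg : Measurable g) :
    Measurable (empirical (d := d) ε g) :=
  (measurable_sum_embedding hg).const_mul _

/-- The normalisation by `μ ^ n` cancels the activity of the `n` particles, and `corr ≤ 1` removes
the interaction. -/
theorem lintegral_enorm_empirical_le {ε : ℝ} (hε : 0 < ε) {g : (Fin n → Phase d) → ℝ}
    (hg : Measurable g) :
    ∫⁻ ω, ‖empirical ε g ω‖ₑ ∂(gibbs d ε) ≤ ∫⁻ X, ‖g X‖ₑ ∂(refMeasure d n) := by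
  have hz := activity_pos d hε
  have h1 : ∀ ω : Config d, ‖empirical ε g ω‖ₑ ≤ ENNReal.ofReal ((activity d ε ^ n)⁻¹) *
      ∑ k : Fin n ↪ Fin ω.1, ‖g fun i => ω.2 (k i)‖ₑ := fun ω => by
    rw [empirical, enorm_mul, Real.enorm_of_nonneg (by positivity)]
    exact mul_le_mul_right (enorm_sum_le _ _) _
  refine (lintegral_mono h1).trans ?_
  rw [lintegral_const_mul' _ _ ENNReal.ofReal_ne_top, lintegral_gibbs_sum hε hg.enorm,
    ← mul_assoc, ← ENNReal.ofReal_mul (by positivity),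
    inv_mul_cancel₀ (by positivity : activity d ε ^ n ≠ 0), ENNReal.ofReal_one, one_mul]
  refine lintegral_mono fun X => mul_le_of_le_one_right' (ENNReal.ofReal_le_one.2 ?_)
  exact corr_le_one (measurableSet_apart d ε) _ hz.le X

theorem integrable_empirical {ε : ℝ} (hε : 0 < ε) {g : (Fin n → Phase d) → ℝ}
    (hg : Measurable g) (hi : ∫⁻ X, ‖g X‖ₑ ∂(refMeasure d n) ≠ ∞) :
    Integrable (empirical ε g) (gibbs d ε) :=
  ⟨(measurable_empirical ε hg).aestronglyMeasurable,
    (lintegral_enorm_empirical_le hε hg).trans_lt hi.lt_top⟩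

theorem abs_mean_le {ε c : ℝ} (hε : 0 < ε) (hc : 0 ≤ c) {g : (Fin n → Phase d) → ℝ}
    (hg : Measurable g) (hi : ∫⁻ X, ‖g X‖ₑ ∂(refMeasure d n) ≤ ENNReal.ofReal c) :
    |mean ε g| ≤ c := by
  rw [← ENNReal.ofReal_le_ofReal_iff hc, ← Real.enorm_eq_ofReal_abs]
  exact (enorm_integral_le_lintegral_enorm _).trans
    ((lintegral_enorm_empirical_le hε hg).trans hi)

theorem mean_eq_of_nonneg {ε : ℝ} (hε : 0 < ε) {g : (Fin n → Phase d) → ℝ}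
    (hg : Measurable g) (h0 : ∀ X, 0 ≤ g X) :
    mean ε g = ∫ X, g X * corr (Apart d ε) (particle d) (activity d ε) X ∂(refMeasure d n) := by
  have hz := activity_pos d hε
  have hcorr := fun X : Fin n → Phase d => corr_nonneg (Apart d ε) (particle d) hz.le X
  rw [mean, integral_eq_lintegral_of_nonneg_ae (f := empirical ε g) (Filter.Eventually.of_forall fun ω =>
      mul_nonneg (by positivity) (Finset.sum_nonneg fun k _ => h0 _))
      (measurable_empirical ε hg).aestronglyMeasurable,
    integral_eq_lintegral_of_nonneg_ae (Filter.Eventually.of_forall fun X =>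
      mul_nonneg (h0 X) (hcorr X)) (hg.mul (measurable_corr (measurableSet_apart d ε) _
        _)).aestronglyMeasurable]
  congr 1
  have h1 : ∀ ω : Config d, ENNReal.ofReal (empirical ε g ω) =
      ENNReal.ofReal ((activity d ε ^ n)⁻¹) *
        ∑ k : Fin n ↪ Fin ω.1, ENNReal.ofReal (g fun i => ω.2 (k i)) := fun ω => by
    rw [empirical, ENNReal.ofReal_mul (by positivity),
      ENNReal.ofReal_sum_of_nonneg fun k _ => h0 _]
  simp only [h1]
  rw [lintegral_const_mul' _ _ ENNReal.ofReal_ne_top, lintegral_gibbs_sum hε hg.ennreal_ofReal,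
    ← mul_assoc, ← ENNReal.ofReal_mul (by positivity),
    inv_mul_cancel₀ (by positivity : activity d ε ^ n ≠ 0), ENNReal.ofReal_one, one_mul]
  simp only [ENNReal.ofReal_mul (h0 _)]

theorem integrable_mul_corr {ε : ℝ} (hε : 0 < ε) {g : (Fin n → Phase d) → ℝ}
    (hg : Integrable g (refMeasure d n)) :
    Integrable (fun X => g X * corr (Apart d ε) (particle d) (activity d ε) X)
      (refMeasure d n) := by
  have hz := activity_pos d hε
  refine hg.mul_bdd (c := 1) (measurable_corr (measurableSet_apart d ε) _ _).aestronglyMeasurable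
    (Filter.Eventually.of_forall fun X => ?_)
  rw [Real.norm_of_nonneg (corr_nonneg _ _ hz.le X)]
  exact corr_le_one (measurableSet_apart d ε) _ hz.le X

theorem mean_eq {ε : ℝ} (hε : 0 < ε) {g : (Fin n → Phase d) → ℝ}
    (hg : Measurable g) (hi : Integrable g (refMeasure d n)) :
    mean ε g = ∫ X, g X * corr (Apart d ε) (particle d) (activity d ε) X ∂(refMeasure d n) := by
  have hsplit : ∀ X, g X = max (g X) 0 - max (-g X) 0 := fun X => by
    rcases le_total 0 (g X) with h | h
    · rw [max_eq_left h, max_eq_right (by linarith), sub_zero]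
    · rw [max_eq_right h, max_eq_left (by linarith)]; ring
  have hp : Measurable fun X => max (g X) 0 := hg.max measurable_const
  have hm : Measurable fun X => max (-g X) 0 := hg.neg.max measurable_const
  have hpi : Integrable (fun X => max (g X) 0) (refMeasure d n) := hi.pos_part
  have hmi : Integrable (fun X => max (-g X) 0) (refMeasure d n) := hi.neg_part
  have h1 : ∀ ω : Config d, empirical ε g ω = empirical ε (fun X => max (g X) 0) ω -
      empirical ε (fun X => max (-g X) 0) ω := fun ω => by
    simp only [empirical, ← mul_sub, ← Finset.sum_sub_distrib, ← hsplit]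
  have h2 : mean ε g = mean ε (fun X => max (g X) 0) - mean ε (fun X => max (-g X) 0) := by
    simp only [mean, h1]
    exact integral_sub (integrable_empirical hε hp hpi.2.ne) (integrable_empirical hε hm hmi.2.ne)
  rw [h2, mean_eq_of_nonneg hε hp fun _ => le_max_right _ _,
    mean_eq_of_nonneg hε hm fun _ => le_max_right _ _,
    ← integral_sub (integrable_mul_corr hε hpi) (integrable_mul_corr hε hmi)]
  simp only [← sub_mul, ← hsplit]

end Gibbs

/-! ### Counting pairs of tuples by their common elements -/

section Embeddings

theorem exists_perm_of_map_eq {α γ : Type*} [Fintype α] {i j : α ↪ γ} (h : Finset.univ.map i = Finset.univ.map j) :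
    ∃ σ : Equiv.Perm α, j = σ.toEmbedding.trans i := by
  classical
  have hr : Set.range j = Set.range i := by
    ext y
    have := Finset.ext_iff.1 h y
    simpa using this.symm
  refine ⟨((Equiv.ofInjective j j.injective).trans (Equiv.setCongr hr)).trans
    (Equiv.ofInjective i i.injective).symm, ?_⟩
  ext a
  simp only [Function.Embedding.trans_apply, Equiv.coe_toEmbedding, Equiv.trans_apply,
    Equiv.apply_ofInjective_symm]
  rfl

/-- Two embeddings with the same image differ by a permutation of the source, so a symmetric
function sees only the image. Sums over tuples thereby become sums over finite sets. -/
theorem exists_eq_comp_map {α γ : Type*} [Fintype α] (G : (α ↪ γ) → ℝ)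
    (hG : ∀ (σ : Equiv.Perm α) (i : α ↪ γ), G (σ.toEmbedding.trans i) = G i) :
    ∃ φ : Finset γ → ℝ, ∀ i, G i = φ (Finset.univ.map i) := by
  classical
  refine ⟨fun s => if h : ∃ i : α ↪ γ, Finset.univ.map i = s then G h.choose else 0, fun i => ?_⟩
  have h : ∃ i' : α ↪ γ, Finset.univ.map i' = Finset.univ.map i := ⟨i, rfl⟩
  simp only [dif_pos h]
  obtain ⟨σ, hσ⟩ := exists_perm_of_map_eq h.choose_spec
  conv_lhs => rw [hσ]
  exact hG σ _

theorem map_univ_sum {α β γ : Type*} [Fintype α] [Fintype β] [DecidableEq γ]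
    (k : α ⊕ β ↪ γ) : Finset.univ.map k =
    Finset.univ.map (Function.Embedding.inl.trans k) ∪
      Finset.univ.map (Function.Embedding.inr.trans k) := by
  ext y
  simp

variable {α β δ γ : Type*} [Fintype α] [Fintype β] [Fintype δ] [Fintype γ] [DecidableEq γ]

theorem card_filter_map_eq [DecidableEq α] (i₀ : α ↪ γ) :
    (Finset.univ.filter fun i : α ↪ γ => Finset.univ.map i = Finset.univ.map i₀).card =
      (Fintype.card α).factorial := by
  have h : (Finset.univ.filter fun i : α ↪ γ => Finset.univ.map i = Finset.univ.map i₀) =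
      Finset.univ.image fun σ : Equiv.Perm α => σ.toEmbedding.trans i₀ := by
    ext i
    simp only [Finset.mem_filter, Finset.mem_univ, true_and, Finset.mem_image]
    refine ⟨fun h => ?_, ?_⟩
    · obtain ⟨σ, hσ⟩ := exists_perm_of_map_eq h.symm
      exact ⟨σ, hσ.symm⟩
    · rintro ⟨σ, rfl⟩
      rw [← Finset.map_map, Finset.map_univ_equiv]
  rw [h, Finset.card_image_of_injective, Finset.card_univ, Fintype.card_perm]
  intro σ τ hστ
  ext a
  exact i₀.injective (DFunLike.congr_fun hστ a)

theorem sum_embedding_map [DecidableEq α] (φ : Finset γ → ℝ) :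
    ∑ i : α ↪ γ, φ (Finset.univ.map i) = ((Fintype.card α).factorial : ℝ) *
      ∑ s ∈ Finset.powersetCard (Fintype.card α) Finset.univ, φ s := by
  have hmaps : ∀ i ∈ (Finset.univ : Finset (α ↪ γ)),
      Finset.univ.map i ∈ Finset.powersetCard (Fintype.card α) (Finset.univ : Finset γ) :=
    fun i _ => Finset.mem_powersetCard_univ.2 (by rw [Finset.card_map, Finset.card_univ])
  rw [← Finset.sum_fiberwise_of_maps_to hmaps, Finset.mul_sum]
  refine Finset.sum_congr rfl fun s hs => ?_
  have hcard : Fintype.card α = Fintype.card s := by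
    rw [Fintype.card_coe, Finset.mem_powersetCard_univ.1 hs]
  set i₀ : α ↪ γ := (Fintype.equivOfCardEq hcard).toEmbedding.trans
    (Function.Embedding.subtype (· ∈ s)) with hi₀
  have hs₀ : s = Finset.univ.map i₀ := by
    rw [hi₀, ← Finset.map_map, Finset.map_univ_equiv]
    ext y
    simp
  have h1 : ∀ i ∈ Finset.univ.filter fun i : α ↪ γ => Finset.univ.map i = s,
      φ (Finset.univ.map i) = φ s := fun i hi => by rw [(Finset.mem_filter.1 hi).2]
  rw [Finset.sum_congr rfl h1, Finset.sum_const, nsmul_eq_mul]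
  conv_lhs => rw [hs₀, card_filter_map_eq, ← hs₀]

theorem sum_embedding_sum (Ψ : (α ↪ γ) → (β ↪ γ) → ℝ) :
    ∑ k : α ⊕ β ↪ γ, Ψ (Function.Embedding.inl.trans k) (Function.Embedding.inr.trans k) =
      ∑ i : α ↪ γ, ∑ j : β ↪ γ,
        if Disjoint (Finset.univ.map i) (Finset.univ.map j) then Ψ i j else 0 := by
  have hdisj : ∀ (i : α ↪ γ) (j : β ↪ γ), Disjoint (Set.range i) (Set.range j) ↔
      Disjoint (Finset.univ.map i) (Finset.univ.map j) := fun i j => by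
    rw [← Finset.disjoint_coe]
    simp
  rw [← Fintype.sum_prod_type' (f := fun i j => if Disjoint (Finset.univ.map i)
    (Finset.univ.map j) then Ψ i j else 0), ← Finset.sum_filter]
  refine Finset.sum_bij' (fun k _ => (Function.Embedding.inl.trans k,
    Function.Embedding.inr.trans k))
    (fun p hp => Equiv.sumEmbeddingEquivProdEmbeddingDisjoint.symm
      ⟨p, (hdisj _ _).2 (Finset.mem_filter.1 hp).2⟩) ?_ ?_ ?_ ?_ ?_
  · intro k _
    refine Finset.mem_filter.2 ⟨Finset.mem_univ _, (hdisj _ _).1 ?_⟩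
    exact (Equiv.sumEmbeddingEquivProdEmbeddingDisjoint k).2
  · intro p _
    exact Finset.mem_univ _
  · intro k _
    exact Equiv.sumEmbeddingEquivProdEmbeddingDisjoint.symm_apply_apply k
  · intro p hp
    exact congrArg Subtype.val (Equiv.sumEmbeddingEquivProdEmbeddingDisjoint.apply_symm_apply
      ⟨p, (hdisj _ _).2 (Finset.mem_filter.1 hp).2⟩)
  · intro k _
    rfl

theorem sum_embedding_sum_sum [DecidableEq α] [DecidableEq β] [DecidableEq δ]
    (Φ : Finset γ → Finset γ → Finset γ → ℝ) :
    ∑ k : (α ⊕ β) ⊕ δ ↪ γ,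
      Φ (Finset.univ.map (Function.Embedding.inl.trans (Function.Embedding.inl.trans k)))
        (Finset.univ.map (Function.Embedding.inr.trans (Function.Embedding.inl.trans k)))
        (Finset.univ.map (Function.Embedding.inr.trans k)) =
      ((Fintype.card α).factorial : ℝ) * (Fintype.card β).factorial * (Fintype.card δ).factorial *
        ∑ A ∈ Finset.powersetCard (Fintype.card α) Finset.univ,
        ∑ C ∈ Finset.powersetCard (Fintype.card β) Finset.univ,
        ∑ B ∈ Finset.powersetCard (Fintype.card δ) Finset.univ,
          if Disjoint A C ∧ Disjoint (A ∪ C) B then Φ A C B else 0 := by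
  rw [sum_embedding_sum (fun (i : α ⊕ β ↪ γ) (j : δ ↪ γ) =>
    Φ (Finset.univ.map (Function.Embedding.inl.trans i))
      (Finset.univ.map (Function.Embedding.inr.trans i)) (Finset.univ.map j))]
  simp only [map_univ_sum]
  have h0 : ∀ i : α ⊕ β ↪ γ, _ := fun i => sum_embedding_map (α := δ) fun B =>
    if Disjoint (Finset.univ.map (Function.Embedding.inl.trans i) ∪
      Finset.univ.map (Function.Embedding.inr.trans i)) B then
    Φ (Finset.univ.map (Function.Embedding.inl.trans i))
      (Finset.univ.map (Function.Embedding.inr.trans i)) B else 0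
  simp only [h0]
  rw [sum_embedding_sum (fun (i : α ↪ γ) (j : β ↪ γ) => ((Fintype.card δ).factorial : ℝ) *
    ∑ B ∈ Finset.powersetCard (Fintype.card δ) Finset.univ, if Disjoint (Finset.univ.map i ∪
      Finset.univ.map j) B then Φ (Finset.univ.map i) (Finset.univ.map j) B else 0)]
  have h1 : ∀ i : α ↪ γ, _ := fun i => sum_embedding_map (α := β) fun C =>
    if Disjoint (Finset.univ.map i) C then ((Fintype.card δ).factorial : ℝ) *
      ∑ B ∈ Finset.powersetCard (Fintype.card δ) Finset.univ,
        if Disjoint (Finset.univ.map i ∪ C) B then Φ (Finset.univ.map i) C B else 0 else 0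
  simp only [h1]
  rw [sum_embedding_map (α := α) fun A => ((Fintype.card β).factorial : ℝ) *
    ∑ C ∈ Finset.powersetCard (Fintype.card β) Finset.univ, if Disjoint A C then
      ((Fintype.card δ).factorial : ℝ) * ∑ B ∈ Finset.powersetCard (Fintype.card δ) Finset.univ,
        if Disjoint (A ∪ C) B then Φ A C B else 0 else 0]
  rw [mul_assoc, mul_assoc]
  congr 1
  simp only [Finset.mul_sum]
  refine Finset.sum_congr rfl fun A _ => Finset.sum_congr rfl fun C _ => ?_
  by_cases hAC : Disjoint A C
  · simp only [hAC, if_true, true_and, Finset.mul_sum]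
  · simp [hAC]

/-- A pair `(S, S')` is encoded by the disjoint triple `(S \ S', S ∩ S', S' \ S)`. -/
theorem sum_powersetCard_eq_sum_inter {n m : ℕ} (hmn : m ≤ n) (f : Finset γ → Finset γ → ℝ) :
    ∑ S ∈ Finset.powersetCard n Finset.univ, ∑ S' ∈ Finset.powersetCard m Finset.univ, f S S' =
      ∑ l ∈ Finset.range (m + 1),
        ∑ A ∈ Finset.powersetCard (n - l) Finset.univ, ∑ C ∈ Finset.powersetCard l Finset.univ,
        ∑ B ∈ Finset.powersetCard (m - l) Finset.univ,
          if Disjoint A C ∧ Disjoint (A ∪ C) B then f (A ∪ C) (C ∪ B) else 0 := by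
  rw [← Finset.sum_product']
  have hmaps : ∀ p ∈ Finset.powersetCard n (Finset.univ : Finset γ) ×ˢ
      Finset.powersetCard m (Finset.univ : Finset γ), (p.1 ∩ p.2).card ∈ Finset.range (m + 1) :=
    fun p hp => by
      have h := (Finset.mem_powersetCard_univ.1 (Finset.mem_product.1 hp).2)
      exact Finset.mem_range.2 (Nat.lt_succ_of_le
        ((Finset.card_le_card Finset.inter_subset_right).trans_eq h))
  rw [← Finset.sum_fiberwise_of_maps_to hmaps]
  refine Finset.sum_congr rfl fun l hl => ?_
  have hlm : l ≤ m := Nat.lt_succ_iff.1 (Finset.mem_range.1 hl)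
  simp only [← Finset.sum_product']
  rw [← Finset.sum_filter]
  refine Finset.sum_bij' (fun p _ => (p.1 \ p.2, p.1 ∩ p.2, p.2 \ p.1))
    (fun q _ => (q.1 ∪ q.2.1, q.2.1 ∪ q.2.2)) ?_ ?_ ?_ ?_ ?_
  · rintro ⟨S, S'⟩ hp
    simp only [Finset.mem_filter, Finset.mem_product, Finset.mem_powersetCard_univ] at hp ⊢
    obtain ⟨⟨hS, hS'⟩, hl⟩ := hp
    have h1 := Finset.card_sdiff_add_card_inter S S'
    have h2 := Finset.card_sdiff_add_card_inter S' S
    rw [Finset.inter_comm] at h2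
    refine ⟨⟨by omega, hl, by omega⟩, ?_, ?_⟩
    · rw [Finset.disjoint_left]; intro a; simp; tauto
    · rw [Finset.disjoint_left]; intro a; simp; tauto
  · rintro ⟨A, C, B⟩ hq
    simp only [Finset.mem_filter, Finset.mem_product, Finset.mem_powersetCard_univ] at hq ⊢
    obtain ⟨⟨hA, hC, hB⟩, hAC, hACB⟩ := hq
    have hCB : Disjoint C B := hACB.mono_left Finset.subset_union_right
    have hAB : Disjoint A B := hACB.mono_left Finset.subset_union_left
    refine ⟨⟨?_, ?_⟩, ?_⟩
    · rw [Finset.card_union_of_disjoint hAC]; omega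
    · rw [Finset.card_union_of_disjoint hCB]; omega
    · rw [← hC]
      congr 1
      ext a
      have : a ∈ A → a ∉ B := fun h => Finset.disjoint_left.1 hAB h
      simp only [Finset.mem_inter, Finset.mem_union]
      tauto
  · rintro ⟨S, S'⟩ _
    ext a <;> simp <;> tauto
  · rintro ⟨A, C, B⟩ hq
    simp only [Finset.mem_filter, Finset.mem_product, Finset.mem_powersetCard_univ] at hq
    obtain ⟨-, hAC, hACB⟩ := hq
    have hCB : Disjoint C B := hACB.mono_left Finset.subset_union_right
    have hAB : Disjoint A B := hACB.mono_left Finset.subset_union_left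
    simp only [Prod.mk.injEq]
    refine ⟨?_, ?_, ?_⟩ <;> ext a <;>
      have h1 : a ∈ A → a ∉ C := fun h => Finset.disjoint_left.1 hAC h <;>
      have h2 : a ∈ A → a ∉ B := fun h => Finset.disjoint_left.1 hAB h <;>
      have h3 : a ∈ C → a ∉ B := fun h => Finset.disjoint_left.1 hCB h <;>
      simp only [Finset.mem_sdiff, Finset.mem_inter, Finset.mem_union] <;> tauto
  · rintro ⟨S, S'⟩ _
    congr 1
    · ext a; simp; tauto
    · ext a; simp; tauto

end Embeddings

/-! ### Products of empirical sums -/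

section Products

variable {d n m : ℕ}

/-- The arguments of `overlap` come in three consecutive blocks, seen by `g` only, by both, and by
`h` only. Both sides become sums over the images `A`, `C`, `B` of these blocks, each counted with
all its orderings. -/
theorem sum_overlap_eq {g : (Fin n → Phase d) → ℝ} {h : (Fin m → Phase d) → ℝ} {l : ℕ}
    (hln : l ≤ n) (hlm : l ≤ m) {N : ℕ} (Z : Fin N → Phase d) {φ ψ : Finset (Fin N) → ℝ}
    (hφ : ∀ i : Fin n ↪ Fin N, g (fun a => Z (i a)) = φ (Finset.univ.map i))
    (hψ : ∀ i : Fin m ↪ Fin N, h (fun a => Z (i a)) = ψ (Finset.univ.map i)) :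
    ∑ k : Fin (n + m - l) ↪ Fin N, overlap g h l (fun a => Z (k a)) =
      ((n - l).factorial : ℝ) * l.factorial * (m - l).factorial *
        ∑ A ∈ Finset.powersetCard (n - l) Finset.univ, ∑ C ∈ Finset.powersetCard l Finset.univ,
        ∑ B ∈ Finset.powersetCard (m - l) Finset.univ,
          if Disjoint A C ∧ Disjoint (A ∪ C) B then φ (A ∪ C) * ψ (C ∪ B) else 0 := by
  let e : (Fin (n - l) ⊕ Fin l) ⊕ Fin (m - l) ≃ Fin (n + m - l) :=
    ((finSumFinEquiv.sumCongr (Equiv.refl _)).trans finSumFinEquiv).trans (finCongr (by omega))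
  have he1 : ∀ a, ((e (Sum.inl (Sum.inl a)) : Fin _) : ℕ) = a := fun a => by simp [e]
  have he2 : ∀ a, ((e (Sum.inl (Sum.inr a)) : Fin _) : ℕ) = n - l + a := fun a => by simp [e]
  have he3 : ∀ a, ((e (Sum.inr a) : Fin _) : ℕ) = n + a := fun a => by simp [e]; omega
  have hsum := sum_embedding_sum_sum (α := Fin (n - l)) (β := Fin l) (δ := Fin (m - l))
    (γ := Fin N) fun A C B => φ (A ∪ C) * ψ (C ∪ B)
  simp only [Fintype.card_fin] at hsum
  rw [← hsum]
  refine Fintype.sum_equiv (Equiv.embeddingCongr e.symm (Equiv.refl _)) _ _ fun k => ?_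
  rw [overlap, dif_pos ⟨hln, hlm⟩]
  let first : Fin n ↪ Fin (n + m - l) := ⟨fun i => ⟨i, by have := i.2; omega⟩,
    fun i j hij => Fin.ext (Fin.mk.inj_iff.1 hij)⟩
  let last : Fin m ↪ Fin (n + m - l) := ⟨fun i => ⟨n - l + i, by have := i.2; omega⟩,
    fun i j hij => Fin.ext (by have := Fin.mk.inj_iff.1 hij; omega)⟩
  have hfirst : ∀ i, ((first i : Fin _) : ℕ) = i := fun i => rfl
  have hlast : ∀ i, ((last i : Fin _) : ℕ) = n - l + i := fun i => rfl
  have h1 := hφ (first.trans k)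
  have h2 := hψ (last.trans k)
  refine (congrArg₂ (· * ·) h1 h2).trans ?_
  congr 2
  · ext y
    simp only [Finset.mem_map, Finset.mem_univ, true_and, Finset.mem_union]
    constructor
    · rintro ⟨i, rfl⟩
      rcases lt_or_ge (i : ℕ) (n - l) with hi | hi
      · exact Or.inl ⟨⟨i, hi⟩, congrArg k (Fin.ext (he1 _))⟩
      · refine Or.inr ⟨⟨i - (n - l), by have := i.2; omega⟩, congrArg k (Fin.ext ?_)⟩
        refine (he2 _).trans ?_
        simp only [hfirst]
        omega
    · rintro (⟨a, rfl⟩ | ⟨a, rfl⟩)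
      · exact ⟨⟨a, by have := a.2; omega⟩, congrArg k (Fin.ext (he1 a).symm)⟩
      · exact ⟨⟨n - l + a, by have := a.2; omega⟩, congrArg k (Fin.ext (he2 a).symm)⟩
  · ext y
    simp only [Finset.mem_map, Finset.mem_univ, true_and, Finset.mem_union]
    constructor
    · rintro ⟨i, rfl⟩
      rcases lt_or_ge (i : ℕ) l with hi | hi
      · exact Or.inl ⟨⟨i, hi⟩, congrArg k (Fin.ext (he2 _))⟩
      · refine Or.inr ⟨⟨i - l, by have := i.2; omega⟩, congrArg k (Fin.ext ?_)⟩
        refine (he3 _).trans ?_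
        simp only [hlast]
        omega
    · rintro (⟨a, rfl⟩ | ⟨a, rfl⟩)
      · exact ⟨⟨a, by have := a.2; omega⟩, congrArg k (Fin.ext (he2 a).symm)⟩
      · refine ⟨⟨l + a, by have := a.2; omega⟩, congrArg k (Fin.ext (Eq.trans ?_ (he3 a).symm))⟩
        simp only [hlast]
        omega

/-- The product of two sums over distinct particles, sorted by the number of common particles. -/
theorem sum_mul_sum_eq_sum_overlap (hmn : m ≤ n) {g : (Fin n → Phase d) → ℝ}
    {h : (Fin m → Phase d) → ℝ} (hg : IsSymm g) (hh : IsSymm h) {N : ℕ} (Z : Fin N → Phase d) :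
    (∑ i : Fin n ↪ Fin N, g fun a => Z (i a)) * ∑ j : Fin m ↪ Fin N, h (fun a => Z (j a)) =
      ∑ l ∈ Finset.range (m + 1), (n.choose l : ℝ) * (m.choose l : ℝ) * (l.factorial : ℝ) *
        ∑ k : Fin (n + m - l) ↪ Fin N, overlap g h l fun a => Z (k a) := by
  obtain ⟨φ, hφ⟩ := exists_eq_comp_map (fun i : Fin n ↪ Fin N => g fun a => Z (i a))
    fun σ i => hg σ fun a => Z (i a)
  obtain ⟨ψ, hψ⟩ := exists_eq_comp_map (fun i : Fin m ↪ Fin N => h fun a => Z (i a))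
    fun σ i => hh σ fun a => Z (i a)
  simp only [hφ, hψ]
  rw [sum_embedding_map, sum_embedding_map, Fintype.card_fin, Fintype.card_fin,
    mul_mul_mul_comm, Finset.sum_mul_sum,
    sum_powersetCard_eq_sum_inter hmn fun S S' => φ S * ψ S', Finset.mul_sum]
  refine Finset.sum_congr rfl fun l hl => ?_
  have hlm : l ≤ m := Nat.lt_succ_iff.1 (Finset.mem_range.1 hl)
  rw [sum_overlap_eq (hlm.trans hmn) hlm Z hφ hψ, ← mul_assoc]
  congr 1
  have h1 : ((n.choose l : ℝ) * l.factorial * (n - l).factorial) = n.factorial := by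
    exact_mod_cast Nat.choose_mul_factorial_mul_factorial (hlm.trans hmn)
  have h2 : ((m.choose l : ℝ) * l.factorial * (m - l).factorial) = m.factorial := by
    exact_mod_cast Nat.choose_mul_factorial_mul_factorial hlm
  rw [← h1, ← h2]
  ring

theorem empirical_mul_empirical (hmn : m ≤ n) {ε : ℝ} (hε : 0 < ε) {g : (Fin n → Phase d) → ℝ}
    {h : (Fin m → Phase d) → ℝ} (hg : IsSymm g) (hh : IsSymm h) (ω : Config d) :
    empirical ε g ω * empirical ε h ω = ∑ l ∈ Finset.range (m + 1),
      (n.choose l : ℝ) * (m.choose l : ℝ) * ((l.factorial : ℝ) / activity d ε ^ l) *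
        empirical ε (overlap g h l) ω := by
  have hz := activity_pos d hε
  simp only [empirical]
  rw [mul_mul_mul_comm, sum_mul_sum_eq_sum_overlap hmn hg hh, Finset.mul_sum]
  refine Finset.sum_congr rfl fun l hl => ?_
  have hlm : l ≤ m := Nat.lt_succ_iff.1 (Finset.mem_range.1 hl)
  have h1 : activity d ε ^ n * activity d ε ^ m =
      activity d ε ^ l * activity d ε ^ (n + m - l) := by
    rw [← pow_add, ← pow_add]
    congr 1
    omega
  rw [← mul_inv, h1]
  field_simp

/-- A sum over all embeddings is already invariant under permutations of the arguments, so
symmetrising changes nothing. -/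
theorem empirical_contraction (ε : ℝ) (g : (Fin n → Phase d) → ℝ) (h : (Fin m → Phase d) → ℝ)
    (l : ℕ) : empirical ε (contraction g h l) = empirical ε (overlap g h l) := by
  funext ω
  simp only [empirical, contraction]
  congr 1
  rw [← Finset.mul_sum, Finset.sum_comm]
  have h1 : ∀ σ : Equiv.Perm (Fin (n + m - l)), ∑ k : Fin (n + m - l) ↪ Fin ω.1,
      overlap g h l (fun i => ω.2 (k (σ i))) =
      ∑ k : Fin (n + m - l) ↪ Fin ω.1, overlap g h l fun i => ω.2 (k i) := fun σ =>
    Fintype.sum_equiv (Equiv.embeddingCongr σ.symm (Equiv.refl _)) _ _ fun k => rfl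
  simp only [h1]
  rw [Finset.sum_const, Finset.card_univ, Fintype.card_perm, Fintype.card_fin, nsmul_eq_mul,
    inv_mul_cancel_left₀ (by positivity)]

end Products

/-! ### Pinned configurations, translations and volumes -/

section Translation

variable {d n : ℕ}

instance isProbabilityMeasure_pinned_factor (d n : ℕ) (i : Fin n) : IsProbabilityMeasure
    (if (i : ℕ) = 0 then Measure.dirac 0 else (volume : Measure (Torus d))) := by
  split_ifs <;> infer_instance

instance isProbabilityMeasure_pinnedMeasure (d n : ℕ) :
    IsProbabilityMeasure (pinnedMeasure d n) := by
  unfold pinnedMeasure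
  infer_instance

theorem measurable_shift : Measurable fun p : Phase d × Torus d => (p.1.1 + p.2, p.1.2) := by
  fun_prop

theorem measurable_translate :
    Measurable fun p : (Fin n → Phase d) × Torus d => translate p.2 p.1 :=
  measurable_pi_iff.2 fun i => by
    have h : Measurable fun p : (Fin n → Phase d) × Torus d => (p.1 i, p.2) :=
      ((measurable_pi_apply i).comp measurable_fst).prodMk measurable_snd
    exact measurable_shift.comp h

theorem lintegral_pinned_shift {s : Set (Phase d)} (hs : MeasurableSet s) :
    ∫⁻ y : Torus d, ((Measure.dirac (0 : Torus d)).prod (maxwellMeasure d))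
      ((fun z : Phase d => (z.1 + y, z.2)) ⁻¹' s) = particle d s := by
  rw [particle, Measure.prod_apply hs]
  refine lintegral_congr fun y => ?_
  have hm : Measurable fun z : Phase d => (z.1 + y, z.2) :=
    measurable_shift.comp (measurable_id.prodMk measurable_const)
  rw [Measure.prod_apply (hm hs), lintegral_dirac' _ (measurable_measure_prodMk_left (hm hs))]
  congr 1
  ext v
  simp

theorem particle_shift (y : Torus d) {s : Set (Phase d)} (hs : MeasurableSet s) :
    particle d ((fun z : Phase d => (z.1 + y, z.2)) ⁻¹' s) = particle d s :=
  ((measurePreserving_add_right (volume : Measure (Torus d)) y).prod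
    (MeasurePreserving.id (maxwellMeasure d))).measure_preimage hs.nullMeasurableSet

/-- The reference measure is the law of a configuration pinned at the origin and then translated
by a uniform vector. -/
theorem measurePreserving_translate (hn : 1 ≤ n) :
    MeasurePreserving (fun p : (Fin n → Phase d) × Torus d => translate p.2 p.1)
      ((pinnedMeasure d n).prod volume) (refMeasure d n) := by
  refine ⟨measurable_translate, ?_⟩
  obtain ⟨n, rfl⟩ := Nat.exists_eq_add_of_le' hn
  refine (Measure.pi_eq fun s hs => ?_).symm
  have hsm : MeasurableSet (Set.univ.pi s) := MeasurableSet.univ_pi hs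
  rw [Measure.map_apply measurable_translate hsm,
    Measure.prod_apply_symm (measurable_translate hsm)]
  have h1 : ∀ y : Torus d, pinnedMeasure d (n + 1)
      ((fun Z => (Z, y)) ⁻¹' ((fun p : (Fin (n + 1) → Phase d) × Torus d =>
        translate p.2 p.1) ⁻¹' Set.univ.pi s)) =
      ((Measure.dirac (0 : Torus d)).prod (maxwellMeasure d))
        ((fun z : Phase d => (z.1 + y, z.2)) ⁻¹' s 0) * ∏ i : Fin n, particle d (s i.succ) := by
    intro y
    have h2 : ((fun Z => (Z, y)) ⁻¹' ((fun p : (Fin (n + 1) → Phase d) × Torus d =>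
        translate p.2 p.1) ⁻¹' Set.univ.pi s)) =
        Set.univ.pi fun i => (fun z : Phase d => (z.1 + y, z.2)) ⁻¹' s i := by
      ext Z
      simp [translate]
    rw [h2, pinnedMeasure, Measure.pi_pi, Fin.prod_univ_succ]
    simp only [Fin.val_zero, if_true, Fin.val_succ, Nat.succ_ne_zero, if_false,
      particle_shift y (hs _)]
  simp only [h1]
  have h3 : Measurable fun y : Torus d => ((Measure.dirac (0 : Torus d)).prod (maxwellMeasure d))
      ((fun z : Phase d => (z.1 + y, z.2)) ⁻¹' s 0) :=
    measurable_measure_prodMk_right (measurable_shift (hs 0))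
  rw [lintegral_mul_const _ h3, lintegral_pinned_shift (hs 0), Fin.prod_univ_succ]

theorem lintegral_refMeasure (hn : 1 ≤ n) {F : (Fin n → Phase d) → ℝ≥0∞} (hF : Measurable F) :
    ∫⁻ X, F X ∂(refMeasure d n) =
      ∫⁻ Z, (∫⁻ y : Torus d, F (translate y Z)) ∂(pinnedMeasure d n) := by
  rw [← (measurePreserving_translate hn).map_eq, lintegral_map hF measurable_translate,
    lintegral_prod _ (by exact (hF.comp measurable_translate).aemeasurable)]

theorem lintegral_enorm_le_transSup (hn : 1 ≤ n) {g : (Fin n → Phase d) → ℝ}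
    (hg : Measurable g) : ∫⁻ X, ‖g X‖ₑ ∂(refMeasure d n) ≤ transSup g := by
  rw [lintegral_refMeasure hn hg.enorm]
  refine lintegral_mono fun Z => ?_
  refine (lintegral_mono fun y => le_iSup (fun y => ‖g (translate y Z)‖ₑ) y).trans_eq ?_
  rw [lintegral_const, measure_univ, mul_one]

/-- Volume of a ball of the torus. -/
theorem volume_torusDist_le (x w : Torus d) {ε : ℝ} (hε : 0 ≤ ε) :
    volume {y : Torus d | torusDist x (w + y) ≤ ε} ≤ ENNReal.ofReal ((2 * ε) ^ d) := by
  -- The Euclidean ball lies in a cube of side `2 * ε`.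
  have hsub : {y : Torus d | torusDist x (w + y) ≤ ε} ⊆
      Set.univ.pi fun k => Metric.closedBall (x k - w k) ε := by
    intro y hy k _
    rw [Metric.mem_closedBall, dist_eq_norm, norm_sub_rev]
    have h1 : ‖x k - (w + y) k‖ ^ 2 ≤ ∑ k, ‖x k - (w + y) k‖ ^ 2 :=
      Finset.single_le_sum (f := fun k => ‖x k - (w + y) k‖ ^ 2) (fun _ _ => by positivity)
        (Finset.mem_univ k)
    have h2 : ‖x k - (w + y) k‖ ≤ ε := (Real.le_sqrt_of_sq_le h1).trans hy
    rwa [show x k - w k - y k = x k - (w + y) k by rw [Pi.add_apply]; abel]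
  refine (measure_mono hsub).trans ?_
  rw [volume_pi_pi, ENNReal.ofReal_pow (by positivity)]
  refine (Finset.prod_le_prod' fun k _ => ?_).trans_eq (by
    rw [Finset.prod_const, Finset.card_univ, Fintype.card_fin])
  rw [AddCircle.volume_closedBall]
  exact ENNReal.ofReal_le_ofReal (min_le_right _ _)

theorem ofReal_clash_apart (ε : ℝ) (z w : Phase d) :
    ENNReal.ofReal (clash (Apart d ε) z w) =
      {x : Torus d | torusDist z.1 x ≤ ε}.indicator 1 w.1 := by
  classical
  rw [clash, Set.indicator_apply]
  by_cases h : Apart d ε z w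
  · rw [if_pos h, if_neg (by exact not_le.2 h), ENNReal.ofReal_zero]
  · rw [if_neg h, if_pos (by exact not_lt.1 h), ENNReal.ofReal_one, Pi.one_apply]

theorem measurableSet_torusDist_le (x w : Torus d) (ε : ℝ) :
    MeasurableSet {y : Torus d | torusDist x (w + y) ≤ ε} :=
  measurableSet_le (measurable_torusDist measurable_const (measurable_const.add measurable_id))
    measurable_const

theorem lintegral_clash_translate_le (z w : Phase d) {ε : ℝ} (hε : 0 ≤ ε) :
    ∫⁻ y : Torus d, ENNReal.ofReal (clash (Apart d ε) z (w.1 + y, w.2)) ≤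
      ENNReal.ofReal ((2 * ε) ^ d) := by
  refine le_trans (le_of_eq ?_) (volume_torusDist_le z.1 w.1 hε)
  rw [← lintegral_indicator_one (measurableSet_torusDist_le z.1 w.1 ε)]
  exact lintegral_congr fun y => ofReal_clash_apart ε z (w.1 + y, w.2)

theorem integral_clash_le (z : Phase d) {ε : ℝ} (hε : 0 ≤ ε) :
    ∫ w, clash (Apart d ε) z w ∂(particle d) ≤ (2 * ε) ^ d := by
  have hm := measurable_clash (measurableSet_apart d ε) z
  rw [integral_eq_lintegral_of_nonneg_ae (Filter.Eventually.of_forall fun w => clash_nonneg _ z w)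
    hm.aestronglyMeasurable]
  refine ENNReal.toReal_le_of_le_ofReal (by positivity) ?_
  rw [particle, lintegral_prod_symm _ hm.ennreal_ofReal.aemeasurable]
  have h : ∀ v : Vel d, ∫⁻ x : Torus d, ENNReal.ofReal (clash (Apart d ε) z (x, v)) ≤
      ENNReal.ofReal ((2 * ε) ^ d) := fun v => by
    simpa using lintegral_clash_translate_le z (0, v) hε
  refine (lintegral_mono h).trans_eq ?_
  rw [lintegral_const, measure_univ, mul_one]

end Translation

/-! ### The covariance of two observables -/

section Covariance

variable {d n m : ℕ}

/-- The truncated correlation functions of the hard sphere gas. -/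
abbrev gibbsTrunc (d : ℕ) (ε : ℝ) (X : Fin n → Phase d) (X' : Fin m → Phase d) : ℝ :=
  truncCorr (Apart d ε) (particle d) (activity d ε) X X'

theorem activity_mul_pow (hd : 1 ≤ d) {ε : ℝ} (hε : 0 < ε) : activity d ε * ε ^ d = ε := by
  obtain ⟨d, rfl⟩ := Nat.exists_eq_add_of_le' hd
  rw [activity, Nat.add_sub_cancel, pow_succ, inv_mul_cancel_left₀ (by positivity)]

/-- At low density, `2 ^ d * ε ≤ 1 / 8`, the clustering estimate applies with `b = (2 * ε) ^ d`.
Otherwise `B = 1` works, since `1 ≤ (2 ^ (d + 3) * ε) ^ d` supplies the missing power of `ε`. -/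
theorem exists_bound_lintegral_gibbsTrunc (hd : 1 ≤ d) {ε : ℝ} (hε : 0 < ε) (n m : ℕ) :
    ∃ B : ℝ, 0 ≤ B ∧ (∀ (X : Fin n → Phase d) (Z : Fin m → Phase d),
      ∫⁻ y : Torus d, ‖gibbsTrunc d ε X (translate y Z)‖ₑ ≤ ENNReal.ofReal B) ∧
      activity d ε * B ≤ 4 * 2 ^ ((d + 3) * d) * 2 ^ (n + m) * ε := by
  have hz := activity_pos d hε
  have hact := activity_mul_pow hd hε
  by_cases hsmall : 2 ^ d * ε ≤ 1 / 8
  · refine ⟨4 * (m * (2 * ε) ^ d) * 2 ^ n, by positivity, fun X Z => ?_, ?_⟩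
    · have h := lintegral_truncCorr_le (measurableSet_apart d ε) Apart.symm (particle d) hz.le
        (a := 2 ^ d * ε) (b := (2 * ε) ^ d) (fun z => ?_) hsmall (by positivity)
        (volume : Measure (Torus d)) (X' := fun y => translate y Z)
        (measurable_translate.comp measurable_prodMk_left)
        (fun z j => lintegral_clash_translate_le z (Z j) hε.le) X
      · simpa only [Fintype.card_fin] using h
      · refine (mul_le_mul_of_nonneg_left (integral_clash_le z hε.le) hz.le).trans_eq ?_
        rw [mul_pow, mul_left_comm, hact]
    · have h1 : (m : ℝ) ≤ 2 ^ m := by exact_mod_cast Nat.lt_two_pow_self.le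
      have h2 : (2 : ℝ) ^ d ≤ 2 ^ ((d + 3) * d) :=
        pow_le_pow_right₀ (by norm_num) (Nat.le_mul_of_pos_left d (by omega))
      calc activity d ε * (4 * (m * (2 * ε) ^ d) * 2 ^ n)
          = 4 * 2 ^ d * (m * 2 ^ n) * (activity d ε * ε ^ d) := by rw [mul_pow]; ring
        _ = 4 * 2 ^ d * (m * 2 ^ n) * ε := by rw [hact]
        _ ≤ 4 * 2 ^ ((d + 3) * d) * (2 ^ m * 2 ^ n) * ε := by gcongr
        _ = 4 * 2 ^ ((d + 3) * d) * 2 ^ (n + m) * ε := by rw [pow_add]; ring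
  · refine ⟨1, zero_le_one, fun X Z => ?_, ?_⟩
    · have h1 : ∀ y, ‖gibbsTrunc d ε X (translate y Z)‖ₑ ≤ 1 := fun y => by
        rw [Real.enorm_eq_ofReal_abs]
        exact ENNReal.ofReal_le_one.2 (abs_truncCorr_le_one (measurableSet_apart d ε) _ hz.le _ _)
      refine (lintegral_mono h1).trans ?_
      rw [lintegral_one, measure_univ, ENNReal.ofReal_one]
    · have h1 : 1 ≤ 2 ^ (d + 3) * ε := by
        rw [pow_add]
        linarith [not_le.1 hsmall]
      have h2 : 1 ≤ 2 ^ ((d + 3) * d) * ε ^ d := by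
        rw [pow_mul, ← mul_pow]
        exact one_le_pow₀ h1
      have h3 : (1 : ℝ) ≤ 2 ^ (n + m) := one_le_pow₀ (by norm_num)
      calc activity d ε * 1 ≤ activity d ε * (2 ^ ((d + 3) * d) * ε ^ d) :=
            mul_le_mul_of_nonneg_left h2 hz.le
        _ = 1 * 2 ^ ((d + 3) * d) * 1 * (activity d ε * ε ^ d) := by ring
        _ ≤ 4 * 2 ^ ((d + 3) * d) * 2 ^ (n + m) * (activity d ε * ε ^ d) := by
          gcongr
          norm_num
        _ = _ := by rw [hact]

/-- The second group is written as a pinned configuration translated by a uniform `y`. Bounding `h`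
by its supremum over translations leaves only the truncated correlation under the `y`-integral,
which is where the bound `B` enters. -/
theorem enorm_integral_mul_trunc_le (hn : 1 ≤ n) (hm : 1 ≤ m) {ε B : ℝ}
    {g : (Fin n → Phase d) → ℝ} {h : (Fin m → Phase d) → ℝ} (hg : Measurable g)
    (hh : Measurable h) (hB : ∀ (X : Fin n → Phase d) (Z : Fin m → Phase d),
      ∫⁻ y : Torus d, ‖gibbsTrunc d ε X (translate y Z)‖ₑ ≤ ENNReal.ofReal B) :
    ‖∫ p : (Fin n → Phase d) × (Fin m → Phase d), g p.1 * h p.2 * gibbsTrunc d ε p.1 p.2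
      ∂((refMeasure d n).prod (refMeasure d m))‖ₑ ≤
      transSup g * (transSup h * ENNReal.ofReal B) := by
  have hu : Measurable fun p : (Fin n → Phase d) × (Fin m → Phase d) =>
      gibbsTrunc d ε p.1 p.2 := measurable_truncCorr (measurableSet_apart d ε) _ _
  have hmeas : Measurable fun p : (Fin n → Phase d) × (Fin m → Phase d) =>
      ‖g p.1 * h p.2 * gibbsTrunc d ε p.1 p.2‖ₑ :=
    (((hg.comp measurable_fst).mul (hh.comp measurable_snd)).mul hu).enorm
  refine (enorm_integral_le_lintegral_enorm _).trans ?_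
  rw [lintegral_prod _ hmeas.aemeasurable]
  have inner : ∀ X : Fin n → Phase d, ∫⁻ X', ‖g X * h X' * gibbsTrunc d ε X X'‖ₑ
      ∂(refMeasure d m) ≤ ‖g X‖ₑ * (transSup h * ENNReal.ofReal B) := fun X => by
    have h1 : ∀ X', ‖g X * h X' * gibbsTrunc d ε X X'‖ₑ =
        ‖g X‖ₑ * (‖h X'‖ₑ * ‖gibbsTrunc d ε X X'‖ₑ) := fun X' => by
      rw [enorm_mul, enorm_mul, mul_assoc]
    simp only [h1]
    rw [lintegral_const_mul' _ _ enorm_ne_top]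
    refine mul_le_mul_right ?_ _
    have h3 : Measurable fun X' => ‖h X'‖ₑ * ‖gibbsTrunc d ε X X'‖ₑ :=
      hh.enorm.mul (hu.comp measurable_prodMk_left).enorm
    rw [lintegral_refMeasure hm h3, transSup,
      ← lintegral_mul_const' _ _ ENNReal.ofReal_ne_top]
    refine lintegral_mono fun Z => ?_
    have h2 : Measurable fun y : Torus d => ‖gibbsTrunc d ε X (translate y Z)‖ₑ :=
      ((hu.comp measurable_prodMk_left).comp
        (measurable_translate.comp measurable_prodMk_left)).enorm
    refine (lintegral_mono fun y => mul_le_mul_left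
      (le_iSup (fun y => ‖h (translate y Z)‖ₑ) y) _).trans ?_
    rw [lintegral_const_mul _ h2]
    exact mul_le_mul_right (hB X Z) _
  refine (lintegral_mono inner).trans ?_
  rw [lintegral_mul_const _ hg.enorm]
  exact mul_le_mul_left (lintegral_enorm_le_transSup hn hg) _

theorem measurable_overlap {g : (Fin n → Phase d) → ℝ} {h : (Fin m → Phase d) → ℝ}
    (hg : Measurable g) (hh : Measurable h) (l : ℕ) : Measurable (overlap g h l) := by
  by_cases hl : l ≤ n ∧ l ≤ m
  · have : overlap g h l = fun Z => g (fun i => Z ⟨i, by have := i.2; omega⟩) *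
        h (fun j => Z ⟨n - l + j, by have := j.2; omega⟩) := by
      funext Z
      exact dif_pos hl
    rw [this]
    exact (hg.comp (measurable_comp_index _)).mul (hh.comp (measurable_comp_index _))
  · have : overlap g h l = fun _ => 0 := by
      funext Z
      exact dif_neg hl
    rw [this]
    exact measurable_const

theorem overlap_zero (g : (Fin n → Phase d) → ℝ) (h : (Fin m → Phase d) → ℝ)
    (X : Fin n → Phase d) (X' : Fin m → Phase d) :
    overlap g h 0 (fun c => Sum.elim X X' (finSumFinEquiv.symm c)) = g X * h X' := by
  rw [overlap, dif_pos ⟨Nat.zero_le _, Nat.zero_le _⟩]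
  congr 2
  · funext i
    have : (⟨i, by have := i.2; omega⟩ : Fin (n + m)) = finSumFinEquiv (Sum.inl i) :=
      Fin.ext (by simp)
    rw [this, Equiv.symm_apply_apply, Sum.elim_inl]
  · funext j
    have : (⟨n - 0 + j, by have := j.2; omega⟩ : Fin (n + m)) = finSumFinEquiv (Sum.inr j) :=
      Fin.ext (by simp)
    rw [this, Equiv.symm_apply_apply, Sum.elim_inr]

theorem measurePreserving_append (d n m : ℕ) : MeasurePreserving
    (fun (p : (Fin n → Phase d) × (Fin m → Phase d)) (c : Fin (n + m - 0)) =>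
      Sum.elim p.1 p.2 (finSumFinEquiv.symm c))
    ((refMeasure d n).prod (refMeasure d m)) (refMeasure d (n + m - 0)) :=
  measurePreserving_sumElim_comp (particle d) finSumFinEquiv

theorem integrable_overlap_zero {g : (Fin n → Phase d) → ℝ} {h : (Fin m → Phase d) → ℝ}
    (hg : Measurable g) (hh : Measurable h) (hgi : Integrable g (refMeasure d n))
    (hhi : Integrable h (refMeasure d m)) :
    Integrable (overlap g h 0) (refMeasure d (n + m - 0)) := by
  rw [← (measurePreserving_append d n m).integrable_comp
    (measurable_overlap hg hh 0).aestronglyMeasurable]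
  refine (hgi.mul_prod hhi).congr (Filter.Eventually.of_forall fun p => ?_)
  exact (overlap_zero g h p.1 p.2).symm

/-- The part of the covariance that comes from disjoint groups of particles. -/
theorem mean_overlap_zero_sub {ε : ℝ} (hε : 0 < ε) {g : (Fin n → Phase d) → ℝ}
    {h : (Fin m → Phase d) → ℝ} (hg : Measurable g) (hh : Measurable h)
    (hgi : Integrable g (refMeasure d n)) (hhi : Integrable h (refMeasure d m)) :
    mean ε (overlap g h 0) - mean ε g * mean ε h =
      ∫ p : (Fin n → Phase d) × (Fin m → Phase d), g p.1 * h p.2 * gibbsTrunc d ε p.1 p.2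
        ∂((refMeasure d n).prod (refMeasure d m)) := by
  have hov := measurable_overlap hg hh 0
  have hoi := integrable_overlap_zero hg hh hgi hhi
  have hmp := measurePreserving_append d n m
  have hcorr : ∀ (X : Fin n → Phase d) (X' : Fin m → Phase d),
      corr (Apart d ε) (particle d) (activity d ε)
        (fun c : Fin (n + m - 0) => Sum.elim X X' (finSumFinEquiv.symm c)) =
      corr (Apart d ε) (particle d) (activity d ε) (Sum.elim X X') := fun X X' =>
    corr_comp_equiv _ _ _ (Sum.elim X X') finSumFinEquiv.symm
  have hmeas : Measurable fun X : Fin (n + m - 0) → Phase d => overlap g h 0 X *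
      corr (Apart d ε) (particle d) (activity d ε) X :=
    hov.mul (measurable_corr (measurableSet_apart d ε) _ _)
  have h1 : mean ε (overlap g h 0) = ∫ p : (Fin n → Phase d) × (Fin m → Phase d),
      g p.1 * h p.2 * corr (Apart d ε) (particle d) (activity d ε) (Sum.elim p.1 p.2)
        ∂((refMeasure d n).prod (refMeasure d m)) := by
    rw [mean_eq hε hov hoi, ← hmp.map_eq,
      integral_map hmp.measurable.aemeasurable hmeas.aestronglyMeasurable]
    refine integral_congr_ae (Filter.Eventually.of_forall fun p => ?_)
    simp only [hcorr]
    exact congrArg (· * _) (overlap_zero g h p.1 p.2)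
  have h2 : Integrable (fun p : (Fin n → Phase d) × (Fin m → Phase d) =>
      g p.1 * h p.2 * corr (Apart d ε) (particle d) (activity d ε) (Sum.elim p.1 p.2))
        ((refMeasure d n).prod (refMeasure d m)) := by
    have := (hmp.integrable_comp hmeas.aestronglyMeasurable).2 (integrable_mul_corr hε hoi)
    refine this.congr (Filter.Eventually.of_forall fun p => ?_)
    simp only [Function.comp, hcorr]
    exact congrArg (· * _) (overlap_zero g h p.1 p.2)
  rw [h1, mean_eq hε hg hgi, mean_eq hε hh hhi, ← integral_prod_mul, ← integral_sub h2
    ((integrable_mul_corr hε hgi).mul_prod (integrable_mul_corr hε hhi))]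
  refine integral_congr_ae (Filter.Eventually.of_forall fun p => ?_)
  simp only [gibbsTrunc, truncCorr]
  ring

theorem abs_mean_overlap_zero_sub_le (hd : 1 ≤ d) (hn : 1 ≤ n) (hm : 1 ≤ m) {ε : ℝ} (hε : 0 < ε)
    {g : (Fin n → Phase d) → ℝ} {h : (Fin m → Phase d) → ℝ} (hg : Measurable g)
    (hh : Measurable h) {c₀ c₀' : ℝ} (hc : 0 ≤ c₀) (hc' : 0 ≤ c₀')
    (hgc : transSup g ≤ ENNReal.ofReal c₀) (hhc : transSup h ≤ ENNReal.ofReal c₀') :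
    |activity d ε * (mean ε (overlap g h 0) - mean ε g * mean ε h)| ≤
      4 * 2 ^ ((d + 3) * d) * (2 ^ (n + m) * c₀ * c₀' * ε) := by
  obtain ⟨B, hB0, hB, hBb⟩ := exists_bound_lintegral_gibbsTrunc hd hε n m
  have hz := activity_pos d hε
  have hgi : Integrable g (refMeasure d n) := ⟨hg.aestronglyMeasurable,
    ((lintegral_enorm_le_transSup hn hg).trans hgc).trans_lt ENNReal.ofReal_lt_top⟩
  have hhi : Integrable h (refMeasure d m) := ⟨hh.aestronglyMeasurable,
    ((lintegral_enorm_le_transSup hm hh).trans hhc).trans_lt ENNReal.ofReal_lt_top⟩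
  have h1 : |mean ε (overlap g h 0) - mean ε g * mean ε h| ≤ c₀ * (c₀' * B) := by
    rw [← ENNReal.ofReal_le_ofReal_iff (by positivity), ← Real.enorm_eq_ofReal_abs,
      mean_overlap_zero_sub hε hg hh hgi hhi, ENNReal.ofReal_mul hc, ENNReal.ofReal_mul hc']
    exact (enorm_integral_mul_trunc_le hn hm hg hh hB).trans
      (mul_le_mul' hgc (mul_le_mul_left hhc _))
  rw [abs_mul, abs_of_pos hz]
  calc activity d ε * |mean ε (overlap g h 0) - mean ε g * mean ε h|
      ≤ activity d ε * (c₀ * (c₀' * B)) := mul_le_mul_of_nonneg_left h1 hz.le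
    _ = c₀ * c₀' * (activity d ε * B) := by ring
    _ ≤ c₀ * c₀' * (4 * 2 ^ ((d + 3) * d) * 2 ^ (n + m) * ε) :=
      mul_le_mul_of_nonneg_left hBb (by positivity)
    _ = _ := by ring

theorem integrable_empirical_mul {ε : ℝ} (hε : 0 < ε) (hmn : m ≤ n) {g : (Fin n → Phase d) → ℝ}
    {h : (Fin m → Phase d) → ℝ} (hg : IsSymm g) (hh : IsSymm h)
    (ho : ∀ l ∈ Finset.range (m + 1), Integrable (empirical ε (overlap g h l)) (gibbs d ε)) :
    Integrable (fun ω => empirical ε g ω * empirical ε h ω) (gibbs d ε) := by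
  simp only [empirical_mul_empirical hmn hε hg hh]
  exact integrable_finsetSum _ fun l hl => (ho l hl).const_mul _

theorem integral_empirical_mul {ε : ℝ} (hε : 0 < ε) (hmn : m ≤ n) {g : (Fin n → Phase d) → ℝ}
    {h : (Fin m → Phase d) → ℝ} (hg : IsSymm g) (hh : IsSymm h)
    (ho : ∀ l ∈ Finset.range (m + 1), Integrable (empirical ε (overlap g h l)) (gibbs d ε)) :
    ∫ ω, empirical ε g ω * empirical ε h ω ∂(gibbs d ε) = ∑ l ∈ Finset.range (m + 1),
      (n.choose l : ℝ) * (m.choose l : ℝ) * ((l.factorial : ℝ) / activity d ε ^ l) *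
        mean ε (overlap g h l) := by
  simp only [empirical_mul_empirical hmn hε hg hh]
  rw [integral_finsetSum _ fun l hl => (ho l hl).const_mul _]
  simp only [integral_const_mul, mean]

theorem activity_mul_centred_mul_centred (ε : ℝ) (g : (Fin n → Phase d) → ℝ)
    (h : (Fin m → Phase d) → ℝ) (ω : Config d) :
    activity d ε * centred ε g ω * centred ε h ω = activity d ε *
      (empirical ε g ω * empirical ε h ω - empirical ε g ω * mean ε h -
        mean ε g * empirical ε h ω + mean ε g * mean ε h) := by
  simp only [centred]
  ring

theorem integrable_centred_mul {ε : ℝ} (hε : 0 < ε) {g : (Fin n → Phase d) → ℝ}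
    {h : (Fin m → Phase d) → ℝ} (hgi : Integrable (empirical ε g) (gibbs d ε))
    (hhi : Integrable (empirical ε h) (gibbs d ε))
    (hgh : Integrable (fun ω => empirical ε g ω * empirical ε h ω) (gibbs d ε)) :
    Integrable (fun ω => activity d ε * centred ε g ω * centred ε h ω) (gibbs d ε) := by
  have := isProbabilityMeasure_gibbs d hε
  simp only [activity_mul_centred_mul_centred]
  exact (((hgh.sub (hgi.mul_const _)).sub (hhi.const_mul _)).add (integrable_const _)).const_mul _

theorem integral_centred_mul {ε : ℝ} (hε : 0 < ε) {g : (Fin n → Phase d) → ℝ}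
    {h : (Fin m → Phase d) → ℝ} (hgi : Integrable (empirical ε g) (gibbs d ε))
    (hhi : Integrable (empirical ε h) (gibbs d ε))
    (hgh : Integrable (fun ω => empirical ε g ω * empirical ε h ω) (gibbs d ε)) :
    ∫ ω, activity d ε * centred ε g ω * centred ε h ω ∂(gibbs d ε) = activity d ε *
      (∫ ω, empirical ε g ω * empirical ε h ω ∂(gibbs d ε) - mean ε g * mean ε h) := by
  have := isProbabilityMeasure_gibbs d hε
  simp only [activity_mul_centred_mul_centred]
  have h1 := hgh.sub (hgi.mul_const (mean ε h))
  have h2 := h1.sub (hhi.const_mul (mean ε g))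
  rw [integral_const_mul]
  congr 1
  calc _ = ∫ ω, (empirical ε g ω * empirical ε h ω - empirical ε g ω * mean ε h -
        mean ε g * empirical ε h ω) ∂(gibbs d ε) + ∫ _, mean ε g * mean ε h ∂(gibbs d ε) :=
        integral_add h2 (integrable_const _)
    _ = ∫ ω, (empirical ε g ω * empirical ε h ω - empirical ε g ω * mean ε h) ∂(gibbs d ε) -
        ∫ ω, mean ε g * empirical ε h ω ∂(gibbs d ε) + mean ε g * mean ε h := by
        congr 1
        · exact integral_sub h1 (hhi.const_mul _)
        · simp
    _ = _ := by
        rw [integral_sub hgh (hgi.mul_const _), integral_mul_const, integral_const_mul]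
        simp only [mean]
        ring

/-- The powers of the activity cancel, `binom n l * l! ≤ n ^ l` removes the dependence on `n`, and
`binom m l ≤ 2 ^ m`. -/
theorem contraction_term_le {ε c : ℝ} (hε : 0 < ε) {l : ℕ} (hn : 1 ≤ n) (hc : 0 ≤ c)
    {a : ℝ} (ha : |a| ≤ activity d ε ^ (l - 1) / (n : ℝ) ^ l * c) :
    |(n.choose l : ℝ) * (m.choose l : ℝ) * ((l.factorial : ℝ) / activity d ε ^ (l - 1)) * a| ≤
      2 ^ m * c := by
  have hz := activity_pos d hε
  have hn' : (0 : ℝ) < n := by exact_mod_cast hn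
  have h1 : (n.choose l : ℝ) * l.factorial ≤ (n : ℝ) ^ l := by
    have := Nat.descFactorial_le_pow n l
    rw [Nat.descFactorial_eq_factorial_mul_choose, mul_comm] at this
    exact_mod_cast this
  have h2 : (m.choose l : ℝ) ≤ 2 ^ m := by exact_mod_cast Nat.choose_le_two_pow m l
  rw [abs_mul, abs_of_nonneg (by positivity)]
  calc (n.choose l : ℝ) * (m.choose l : ℝ) * ((l.factorial : ℝ) / activity d ε ^ (l - 1)) * |a|
      ≤ (n.choose l : ℝ) * (m.choose l : ℝ) * ((l.factorial : ℝ) / activity d ε ^ (l - 1)) *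
          (activity d ε ^ (l - 1) / (n : ℝ) ^ l * c) :=
        mul_le_mul_of_nonneg_left ha (by positivity)
    _ = ((n.choose l : ℝ) * l.factorial) / (n : ℝ) ^ l * ((m.choose l : ℝ) * c) := by field_simp
    _ ≤ 1 * (2 ^ m * c) := by
        gcongr
        exact div_le_one_of_le₀ h1 (by positivity)
    _ = _ := one_mul _

end Covariance

end HardSphere

end

/-! ### The quasi-orthogonality estimates -/

theorem mainTheorem3 (d : ℕ) (hd : 3 ≤ d) :
    ∃ C : ℝ, 0 < C ∧ ∃ K : ℝ, 0 < K ∧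
      ∀ (ε : ℝ), 0 < ε → ∀ (n m : ℕ), 1 ≤ m → m ≤ n →
      ∀ (g : (Fin n → HardSphere.Phase d) → ℝ) (h : (Fin m → HardSphere.Phase d) → ℝ),
        Measurable g → Measurable h →
      ∀ (c₀ c₀' : ℝ) (c : ℕ → ℝ), 0 ≤ c₀ → 0 ≤ c₀' → (∀ l ∈ Finset.Icc 1 m, 0 ≤ c l) →
        HardSphere.transSup g ≤ ENNReal.ofReal c₀ →
        HardSphere.transSup h ≤ ENNReal.ofReal c₀' →
        (∀ l ∈ Finset.Icc 1 m, HardSphere.transSup (HardSphere.overlap g h l) ≤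
          ENNReal.ofReal (HardSphere.activity d ε ^ (l - 1) / (n : ℝ) ^ l * c l)) →
        -- the expectations
        (Integrable (HardSphere.empirical ε g) (HardSphere.gibbs d ε) ∧
          Integrable (HardSphere.empirical ε h) (HardSphere.gibbs d ε) ∧
          |HardSphere.mean ε g| ≤ C ^ n * c₀ ∧
          |HardSphere.mean ε h| ≤ C ^ m * c₀') ∧
        -- the covariance
        (HardSphere.IsSymm g → HardSphere.IsSymm h →
          Integrable (fun ω => HardSphere.activity d ε * HardSphere.centred ε g ω *
            HardSphere.centred ε h ω) (HardSphere.gibbs d ε) ∧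
          (∀ l ∈ Finset.Icc 1 m,
            Integrable (HardSphere.empirical ε (HardSphere.contraction g h l))
              (HardSphere.gibbs d ε)) ∧
          |(∫ ω, HardSphere.activity d ε * HardSphere.centred ε g ω *
                HardSphere.centred ε h ω ∂(HardSphere.gibbs d ε)) -
              ∑ l ∈ Finset.Icc 1 m, (n.choose l : ℝ) * (m.choose l : ℝ) *
                ((l.factorial : ℝ) / HardSphere.activity d ε ^ (l - 1)) *
                HardSphere.mean ε (HardSphere.contraction g h l)|
            ≤ K * (C ^ (n + m) * c₀ * c₀' * ε) ∧
          |∫ ω, HardSphere.activity d ε * HardSphere.centred ε g ω *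
                HardSphere.centred ε h ω ∂(HardSphere.gibbs d ε)|
            ≤ C ^ (n + m) * (∑ l ∈ Finset.Icc 1 m, c l) + C ^ n * c₀ * c₀' * ε) := by
  open HardSphere in
  set K : ℝ := 4 * 2 ^ ((d + 3) * d) with hK
  have hK4 : 4 ≤ K := le_mul_of_one_le_right (by norm_num) (one_le_pow₀ (by norm_num))
  have hC : (1 : ℝ) ≤ 4 * K := by linarith
  refine ⟨4 * K, by linarith, K, by linarith, ?_⟩
  intro ε hε n m hm hmn g h hg hh c₀ c₀' c hc₀ hc₀' hc hgc hhc hoc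
  have hn : 1 ≤ n := hm.trans hmn
  have hz := activity_pos d hε
  have hgb := (lintegral_enorm_le_transSup hn hg).trans hgc
  have hhb := (lintegral_enorm_le_transSup hm hh).trans hhc
  have hgi := integrable_empirical hε hg (hgb.trans_lt ENNReal.ofReal_lt_top).ne
  have hhi := integrable_empirical hε hh (hhb.trans_lt ENNReal.ofReal_lt_top).ne
  refine ⟨⟨hgi, hhi, ?_, ?_⟩, fun hgs hhs => ?_⟩
  · exact (abs_mean_le hε hc₀ hg hgb).trans (le_mul_of_one_le_left hc₀ (one_le_pow₀ hC))
  · exact (abs_mean_le hε hc₀' hh hhb).trans (le_mul_of_one_le_left hc₀' (one_le_pow₀ hC))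
  have hob : ∀ l ∈ Finset.Icc 1 m, ∫⁻ X, ‖overlap g h l X‖ₑ ∂(refMeasure d (n + m - l)) ≤
      ENNReal.ofReal (activity d ε ^ (l - 1) / (n : ℝ) ^ l * c l) := fun l hl => by
    have hl' := Finset.mem_Icc.1 hl
    exact (lintegral_enorm_le_transSup (by omega) (measurable_overlap hg hh l)).trans (hoc l hl)
  have hoi : ∀ l ∈ Finset.Icc 1 m, Integrable (empirical ε (overlap g h l)) (gibbs d ε) :=
    fun l hl => integrable_empirical hε (measurable_overlap hg hh l)
      ((hob l hl).trans_lt ENNReal.ofReal_lt_top).ne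
  have hoi0 : Integrable (empirical ε (overlap g h 0)) (gibbs d ε) :=
    integrable_empirical hε (measurable_overlap hg hh 0)
      (integrable_overlap_zero hg hh
        ⟨hg.aestronglyMeasurable, hgb.trans_lt ENNReal.ofReal_lt_top⟩
        ⟨hh.aestronglyMeasurable, hhb.trans_lt ENNReal.ofReal_lt_top⟩).2.ne
  have hrange : Finset.range (m + 1) = insert 0 (Finset.Icc 1 m) := by
    ext l
    simp only [Finset.mem_range, Finset.mem_insert, Finset.mem_Icc]
    omega
  have hoall : ∀ l ∈ Finset.range (m + 1),
      Integrable (empirical ε (overlap g h l)) (gibbs d ε) := fun l hl => by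
    rw [hrange, Finset.mem_insert] at hl
    rcases hl with rfl | hl
    exacts [hoi0, hoi l hl]
  have hprod := integrable_empirical_mul hε hmn hgs hhs hoall
  have hmean : ∀ l, mean ε (contraction g h l) = mean ε (overlap g h l) := fun l => by
    simp only [mean, empirical_contraction]
  simp only [hmean, empirical_contraction]
  -- The error is an exact expression: it is the `l = 0` term of the product formula, recentred.
  have hmain : (∫ ω, activity d ε * centred ε g ω * centred ε h ω ∂(gibbs d ε)) -
      ∑ l ∈ Finset.Icc 1 m, (n.choose l : ℝ) * (m.choose l : ℝ) *
        ((l.factorial : ℝ) / activity d ε ^ (l - 1)) * mean ε (overlap g h l) =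
      activity d ε * (mean ε (overlap g h 0) - mean ε g * mean ε h) := by
    rw [integral_centred_mul hε hgi hhi hprod, integral_empirical_mul hε hmn hgs hhs hoall, hrange,
      Finset.sum_insert (by simp), mul_sub, mul_add, Finset.mul_sum]
    have hterm : ∀ l ∈ Finset.Icc 1 m, activity d ε * ((n.choose l : ℝ) * (m.choose l : ℝ) *
        ((l.factorial : ℝ) / activity d ε ^ l) * mean ε (overlap g h l)) =
        (n.choose l : ℝ) * (m.choose l : ℝ) *
        ((l.factorial : ℝ) / activity d ε ^ (l - 1)) * mean ε (overlap g h l) := fun l hl => by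
      obtain ⟨k, rfl⟩ := Nat.exists_eq_add_of_le' (Finset.mem_Icc.1 hl).1
      rw [Nat.add_sub_cancel, pow_succ]
      field_simp
    rw [Finset.sum_congr rfl hterm]
    simp only [Nat.choose_zero_right, Nat.factorial_zero, pow_zero, Nat.cast_one]
    ring
  have hest := abs_mean_overlap_zero_sub_le (by omega : 1 ≤ d) hn hm hε hg hh hc₀ hc₀' hgc hhc
  rw [← hK] at hest
  have hP : 0 ≤ c₀ * c₀' * ε := by positivity
  refine ⟨integrable_centred_mul hε hgi hhi hprod, hoi, ?_, ?_⟩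
  · rw [hmain]
    refine hest.trans (mul_le_mul_of_nonneg_left ?_ (by linarith))
    have : (2 : ℝ) ^ (n + m) ≤ (4 * K) ^ (n + m) := pow_le_pow_left₀ (by norm_num) (by linarith) _
    nlinarith
  · rw [sub_eq_iff_eq_add.1 hmain, add_comm]
    refine (abs_add_le _ _).trans (add_le_add ?_ (hest.trans ?_))
    · refine (Finset.abs_sum_le_sum_abs _ _).trans ?_
      rw [Finset.mul_sum]
      refine Finset.sum_le_sum fun l hl => ?_
      have hcl := hc l hl
      refine (contraction_term_le hε hn hcl (abs_mean_le hε (by positivity)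
        (measurable_overlap hg hh l) (hob l hl))).trans (mul_le_mul_of_nonneg_right ?_ hcl)
      calc (2 : ℝ) ^ m ≤ (4 * K) ^ m := pow_le_pow_left₀ (by norm_num) (by linarith) _
        _ ≤ (4 * K) ^ (n + m) := pow_le_pow_right₀ hC (by omega)
    -- The constant `C = 4 * K` is chosen for this: `K ≤ K ^ n` because `n ≥ 1`, and `2 ^ (n + m) ≤
    -- 4 ^ n` because `m ≤ n`.
    · have h1 : K * 2 ^ (n + m) ≤ (4 * K) ^ n := by
        calc K * 2 ^ (n + m) ≤ K ^ n * 4 ^ n := by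
              refine mul_le_mul (le_self_pow₀ (by linarith) (by omega)) ?_ (by positivity)
                (by positivity)
              have h4 : (4 : ℝ) ^ n = 2 ^ (2 * n) := by rw [pow_mul]; norm_num
              rw [h4]
              exact pow_le_pow_right₀ (by norm_num) (by omega)
          _ = (4 * K) ^ n := by rw [mul_pow 4 K, mul_comm]
      calc K * (2 ^ (n + m) * c₀ * c₀' * ε) = K * 2 ^ (n + m) * (c₀ * c₀' * ε) := by ring
        _ ≤ (4 * K) ^ n * (c₀ * c₀' * ε) := mul_le_mul_of_nonneg_right h1 hP
        _ = _ := by ring
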